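/- For coprime positive integers $a,b$ with $\frac ab>1$, let $\mathbf w_{a/b}$ be the lexicographically least infinite word on the alphabet $\mathbb Z_{\ge 0}$ none of whose factors is an $\frac ab$-power. Here an $\frac ab$-power is a word $x^{a/b}=x^{\lfloor a/b\rfloor}x'$, where $x$ is a nonempty word whose length is divisible by $b$ and $x'$ is the prefix of $x$ of length $\left(\frac ab-\lfloor \frac ab\rfloor\right)|x|$. For $k\ge 2$, a sequence $s(i)_{i\ge0}$ of integers is $k$-regular if the $\mathbb Z$-module generated by the sequences $s(k^ei+j)_{i\ge 0}$ with $e\ge 0$ and $0\le j\le k^e-1$ is finitely generated. We write $\rho(\frac ab)=k$ if the integers $l\ge 2$ for which the sequence of letters of $\mathbf w_{a/b}$ is $l$-regular are exactly those that are multiplicatively dependent on $k$, that is, $l^s=k^t$ for some integers $s,t\ge 1$. Let $a,b$ be relatively prime positive integers such that $\frac97<\frac ab<\frac43$ and $\gcd(b,24)=1$. Let $\varphi$ be the $(24a-15b)$-uniform morphism on $\mathbb Z_{\ge 0}$ defined by \begin{align*} \varphi(n) = {} & 0^{a-b-1}\,1\,0^{2a-2b-1}\,1\,0^{-a+2b-1}\,1\,0^{2a-2b-1}\,1\,0^{a-b-1}\,1\,0^{-2a+3b-1}\,1\,0^{4a-5b-1}\,1\\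 & 0^{-a+2b-1}\,1\,0^{2a-2b-1}\,1\,0^{a-b-1}\,1\,0^{-2a+3b-1}\,1\,0^{-2a+3b-1}\,1\,0^{5a-6b-1}\,1\\ & 0^{-2a+3b-1}\,1\,0^{4a-5b-1}\,1\,0^{a-b-1}\,1\,0^{-2a+3b-1}\,1\,0^{3a-3b-1}\,1\,0^{-2a+3b-1}\,1\\ & 0^{a-b-1}\,1\,0^{-3a+4b-1}\,1\,0^{5a-6b-1}\,1\,0^{2a-2b-1}\,1\,0^{a-b-1}\,1\,0^{-2a+3b-1}\,1\\ & 0^{3a-3b-1}\,1\,0^{-2a+3b-1}\,1\,0^{4a-5b-1}\,1\,0^{a-b-1}\,1\,0^{-2a+3b-1}\,1\,0^{2a-2b-1}\,2\\ & 0^{a-b-1}\,1\,0^{-2a+3b-1}\,1\,0^{3a-3b-1}\,1\,0^{-2a+3b-1}\,1\,0^{a-b-1}\,1\,0^{a-b-1}\,(n+2), \end{align*} and extend it to the alphabet $\mathbb Z_{\ge 0}\cup\{0'\}$ by $\varphi(0')=v\,\varphi(0)$, where \[ v = 0'\,0^{a-2}\,1\,0^{a-b-1}\,1\,0^{a-b-1}\,1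 . \] Let $\varphi^\infty(0')$ be the infinite word beginning with $0'$ that is obtained by iterating $\varphi$ on $0'$, and let $\tau$ be the letter-to-letter map with $\tau(0')=0$ and $\tau(n)=n$ for $n\in\mathbb Z_{\ge0}$. Then $\mathbf w_{a/b}=\tau(\varphi^\infty(0'))$. In particular, $\rho(\frac ab)=24a-15b$. -/

import Mathlib

namespace LexLeast

/-! Finite words over `α` are lists, infinite words are functions `ℕ → α`. -/

/-- The fractional power `v ^ (a / b)` of a finite word `v` whose length is divisible by `b`:
`⌊a / b⌋` copies of `v`, followed by the prefix of `v` of length `|v| * (a / b - ⌊a / b⌋)`. -/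
def fracPow {α : Type*} (a b : ℕ) (v : List α) : List α :=
  (List.replicate (a / b) v).flatten ++ v.take (v.length * (a % b) / b)

/-- The finite word `x` is an `a / b`-power. -/
def IsFracPow {α : Type*} (a b : ℕ) (x : List α) : Prop :=
  ∃ v : List α, v ≠ [] ∧ b ∣ v.length ∧ x = fracPow a b v

/-- The factor of length `l` of the infinite word `w` that begins at position `i`. -/
def factor {α : Type*} (w : ℕ → α) (i l : ℕ) : List α :=
  (List.range l).map fun j => w (i + j)

/-- The infinite word `w` is `a / b`-power-free: none of its factors is an `a / b`-power. -/
def PowerFree {α : Type*} (a b : ℕ) (w : ℕ → α) : Prop :=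
  ∀ i l : ℕ, ¬ IsFracPow a b (factor w i l)

/-- `w` is the word `𝐰_{a/b}`: the lexicographically least infinite word on the alphabet of
nonnegative integers that avoids `a / b`-powers. -/
def IsLexLeastPowerFree (a b : ℕ) (w : ℕ → ℕ) : Prop :=
  IsLeast {u : Lex (ℕ → ℕ) | PowerFree a b (ofLex u)} (toLex w)

/-- The `k`-kernel of the sequence `s`. -/
def kernel (k : ℕ) (s : ℕ → ℤ) : Set (ℕ → ℤ) :=
  {t | ∃ e j : ℕ, j < k ^ e ∧ t = fun i => s (k ^ e * i + j)}

/-- The sequence `s` is `k`-regular: the `ℤ`-module generated by its `k`-kernel is finitely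
generated. -/
def IsRegular (k : ℕ) (s : ℕ → ℤ) : Prop :=
  (Submodule.span ℤ (kernel k s)).FG

/-- Multiplicative dependence of two integers. -/
def MultDependent (k l : ℕ) : Prop :=
  ∃ s t : ℕ, 0 < s ∧ 0 < t ∧ k ^ s = l ^ t

/-- `ρ(a / b) = k`: the word `𝐰_{a/b}` exists, and the set of all integers `l ≥ 2` for which it
is `l`-regular is the multiplicative dependence class of the integer `k ≥ 2`. -/
def RhoEq (a b k : ℕ) : Prop :=
  2 ≤ k ∧ ∃ w : ℕ → ℕ, IsLexLeastPowerFree a b w ∧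
    {l : ℕ | 2 ≤ l ∧ IsRegular l fun i => (w i : ℤ)} = {l : ℕ | 2 ≤ l ∧ MultDependent l k}

/-- The extension of a morphism to finite words by concatenation. -/
def morphExtend {α : Type*} (φ : α → List α) (w : List α) : List α :=
  w.flatMap φ

/-- The infinite word `φ^∞(c)`, for a morphism `φ` such that `φ c` begins with `c`: its letter
at position `i` is the letter at position `i` of `φ^i(c)`. The two theorems below say that this
letter exists and that each `φ^n(c)` is a prefix of the infinite word. -/
def morphLimit {α : Type*} (φ : α → List α) (c : α) (i : ℕ) : α :=
  ((morphExtend φ)^[i] [c]).getD i c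

theorem morphExtend_iterate_append {α : Type*} (φ : α → List α) (n : ℕ) (x y : List α) :
    (morphExtend φ)^[n] (x ++ y) = (morphExtend φ)^[n] x ++ (morphExtend φ)^[n] y := by
  induction n generalizing x y with
  | zero => rfl
  | succ n ih =>
    rw [Function.iterate_succ_apply, Function.iterate_succ_apply, Function.iterate_succ_apply,
      ← ih]
    simp [morphExtend]

theorem morphExtend_iterate_ne_nil {α : Type*} (φ : α → List α) (hφ : ∀ x, φ x ≠ []) (n : ℕ)
    (x : List α) (hx : x ≠ []) : (morphExtend φ)^[n] x ≠ [] := by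
  induction n generalizing x with
  | zero => exact hx
  | succ n ih =>
    rw [Function.iterate_succ_apply]
    apply ih
    cases x with
    | nil => exact absurd rfl hx
    | cons y ys => simp [morphExtend, hφ y]

theorem morphExtend_iterate_succ {α : Type*} (φ : α → List α) (c : α) (t : List α)
    (hc : φ c = c :: t) (n : ℕ) :
    (morphExtend φ)^[n + 1] [c] = (morphExtend φ)^[n] [c] ++ (morphExtend φ)^[n] t := by
  rw [Function.iterate_succ_apply, ← morphExtend_iterate_append]
  simp [morphExtend, hc]

theorem lt_length_iterate {α : Type*} (φ : α → List α) (hφ : ∀ x, φ x ≠ []) (c : α)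
    (t : List α) (hc : φ c = c :: t) (ht : t ≠ []) (n : ℕ) :
    n < ((morphExtend φ)^[n] [c]).length := by
  induction n with
  | zero => simp
  | succ n ih =>
    rw [morphExtend_iterate_succ φ c t hc, List.length_append]
    have := List.length_pos_iff.mpr (morphExtend_iterate_ne_nil φ hφ n t ht)
    omega

theorem iterate_prefix {α : Type*} (φ : α → List α) (c : α) (t : List α) (hc : φ c = c :: t)
    (m n : ℕ) (hmn : m ≤ n) : (morphExtend φ)^[m] [c] <+: (morphExtend φ)^[n] [c] := by
  induction n, hmn using Nat.le_induction with
  | base => exact List.prefix_rfl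
  | succ n _ ih =>
    rw [morphExtend_iterate_succ φ c t hc]
    exact ih.trans (List.prefix_append _ _)

theorem morphLimit_prefix {α : Type*} (φ : α → List α) (hφ : ∀ x, φ x ≠ []) (c : α)
    (t : List α) (hc : φ c = c :: t) (ht : t ≠ []) (n : ℕ) :
    factor (morphLimit φ c) 0 ((morphExtend φ)^[n] [c]).length = (morphExtend φ)^[n] [c] := by
  apply List.ext_getElem
  · simp [factor]
  · intro i _ h2
    have hi := lt_length_iterate φ hφ c t hc ht i
    simp only [factor, List.getElem_map, List.getElem_range, Nat.zero_add, morphLimit]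
    rw [List.getD_eq_getElem _ _ hi]
    rcases le_total i n with h | h
    · exact (iterate_prefix φ c t hc i n h).getElem hi
    · exact ((iterate_prefix φ c t hc n i h).getElem h2).symm

/-- The alphabet `{0, 1, 2, …} ∪ {0'}`. -/
inductive Letter where
  | num (n : ℕ)
  | zeroPrime

/-- The coding `τ`, with `τ(0') = 0` and `τ(n) = n`. -/
def tau : Letter → ℕ
  | .num n => n
  | .zeroPrime => 0

/-- For `[(e₁, c₁), …, (eᵣ, cᵣ)]`, the word `0^{e₁} c₁ ⋯ 0^{eᵣ} cᵣ`. -/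
def runs (L : List (ℤ × ℕ)) : List ℕ :=
  L.flatMap fun p => List.replicate p.1.toNat 0 ++ [p.2]

/-- The word `φ(n)` for a nonnegative integer `n`. -/
def phiNum (a b : ℤ) (n : ℕ) : List ℕ :=
  runs
    [(a-b-1, 1), (2*a-2*b-1, 1), (-a+2*b-1, 1), (2*a-2*b-1, 1), (a-b-1, 1), (-2*a+3*b-1, 1),
      (4*a-5*b-1, 1),
     (-a+2*b-1, 1), (2*a-2*b-1, 1), (a-b-1, 1), (-2*a+3*b-1, 1), (-2*a+3*b-1, 1),
      (5*a-6*b-1, 1),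
     (-2*a+3*b-1, 1), (4*a-5*b-1, 1), (a-b-1, 1), (-2*a+3*b-1, 1), (3*a-3*b-1, 1),
      (-2*a+3*b-1, 1),
     (a-b-1, 1), (-3*a+4*b-1, 1), (5*a-6*b-1, 1), (2*a-2*b-1, 1), (a-b-1, 1),
      (-2*a+3*b-1, 1),
     (3*a-3*b-1, 1), (-2*a+3*b-1, 1), (4*a-5*b-1, 1), (a-b-1, 1), (-2*a+3*b-1, 1),
      (2*a-2*b-1, 2),
     (a-b-1, 1), (-2*a+3*b-1, 1), (3*a-3*b-1, 1), (-2*a+3*b-1, 1), (a-b-1, 1),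
      (a-b-1, n+2)]

/-- The transient `v = 0' 0^{a-2} 1 0^{a-b-1} 1 0^{a-b-1} 1`. -/
def transient (a b : ℤ) : List Letter :=
  .zeroPrime :: (runs [(a-2, 1), (a-b-1, 1), (a-b-1, 1)]).map .num

/-- The morphism `φ` on `{0, 1, 2, …} ∪ {0'}`, with `φ(0') = v φ(0)`. -/
def phi (a b : ℤ) : Letter → List Letter
  | .num n => (phiNum a b n).map .num
  | .zeroPrime => transient a b ++ (phiNum a b 0).map .num

end LexLeast

namespace LexLeast

/-! ### Linear forms in two positive integers -/

/-! Put `p = 4b - 3a` and `q = 7a - 9b`. The bounds on `a/b` say exactly that `p, q > 0`; then `a =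
9p + 4q`, `b = 7p + 3q`, `a - b = 2p + q`, and all distances between consecutive nonzero letters are
forms `x p + y q` with fixed natural coefficients. Forms that compare coefficientwise compare for
all `p, q > 0`, so finite tables settle all `a/b` at once. Let `k = 111p + 51q = 24a - 15b` (a
block, 37 nonzero letters) and `s = |v| = 13p + 6q`. Counted from position `1`, the word satisfies
`W (s + k x) = W x + 2` for `x ≥ 1`, and its other letters after `v` depend only on the place in the
block.

Power-freeness: as `1 < a/b < 2`, a power is a window of length `m (a - b)` that recurs at distance
`m b`. Comparing gaps around nonzero letters forces `k ∣ m b` (`IsMarked.dvd_of_agree`); since `k`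
is coprime to `b`, `k ∣ m`, and the last letters of the blocks give a power with parameter `m / k`:
descent (`IsSelfSimilar.not_agree`).

Leastness: lowering a letter must complete a power ending there. For the values `0` and `1` a finite
table supplies powers with `m ≤ 2` (`exists_witness`). A larger value concerns a letter `W y + 2`,
and the power at `y` is blown up by the morphism (`IsSelfSimilar.exists_blocks`).

Regularity: let `D = k - 1`. The map `x ↦ s + k x` multiplies `D x + s` by `k`, so if `D x + s = k ^
v * y` with `k ∤ y` and `y` large, then `W x - 2 v` depends only on `y` modulo `k`. Hence `W` is
`k`-regular. If `W` is `l`-regular, its `l`-kernel is finite modulo every `q`, so two kernel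
sequences agree modulo `q`; indices chosen by congruences then change the exponent `v` along one of
them and not along the other. This excludes prime factors of `l` outside `k`
(`IsShiftFixed.eq_one_of_isRegular`) and prime exponents of `l` not proportional to those of `k`
(`IsShiftFixed.le_of_isRegular`). -/

/-- The value `x p + y q` of the linear form `(x, y)`. -/
def formVal (p q : ℕ) (x : ℕ × ℕ) : ℕ := x.1 * p + x.2 * q

/-- Coefficientwise comparison of linear forms. -/
def formLe (x y : ℕ × ℕ) : Bool := Nat.ble x.1 y.1 && Nat.ble x.2 y.2

/-- Equality test for linear forms. -/
def formEq (x y : ℕ × ℕ) : Bool := Nat.beq x.1 y.1 && Nat.beq x.2 y.2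

/-- Coefficientwise comparison of distinct linear forms. -/
def formLt (x y : ℕ × ℕ) : Bool := formLe x y && !formEq x y

theorem formEq_iff {x y : ℕ × ℕ} : formEq x y = true ↔ x = y := by
  simp [formEq, Prod.ext_iff]

theorem formVal_add (p q : ℕ) (x y : ℕ × ℕ) :
    formVal p q (x + y) = formVal p q x + formVal p q y := by
  simp only [formVal, Prod.fst_add, Prod.snd_add]; ring

theorem formVal_le {x y : ℕ × ℕ} (p q : ℕ) (h : formLe x y = true) :
    formVal p q x ≤ formVal p q y := by
  simp only [formLe, Bool.and_eq_true, Nat.ble_eq] at h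
  exact Nat.add_le_add (Nat.mul_le_mul_right _ h.1) (Nat.mul_le_mul_right _ h.2)

theorem formVal_lt {x y : ℕ × ℕ} {p q : ℕ} (hp : 0 < p) (hq : 0 < q) (h : formLt x y = true) :
    formVal p q x < formVal p q y := by
  simp only [formLt, formLe, formEq, Bool.and_eq_true, Nat.ble_eq, Bool.not_eq_true',
    Bool.and_eq_false_iff] at h
  obtain ⟨⟨h1, h2⟩, h3⟩ := h
  have h4 : x.1 < y.1 ∨ x.2 < y.2 := by
    rcases h3 with h3 | h3
    · left; have := Nat.ne_of_beq_eq_false h3; omega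
    · right; have := Nat.ne_of_beq_eq_false h3; omega
  rcases h4 with h4 | h4
  · exact Nat.add_lt_add_of_lt_of_le (Nat.mul_lt_mul_of_pos_right h4 hp)
      (Nat.mul_le_mul_right _ h2)
  · exact Nat.add_lt_add_of_le_of_lt (Nat.mul_le_mul_right _ h1)
      (Nat.mul_lt_mul_of_pos_right h4 hq)

/-! ### The positions of the nonzero letters -/

/-- The distances between consecutive nonzero letters in a block `φ(n)`. -/
def gapCycle : List (ℕ × ℕ) :=
  [(2,1), (4,2), (5,2), (4,2), (2,1), (3,1), (1,1), (5,2), (4,2), (2,1), (3,1), (3,1), (3,2),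
   (3,1), (1,1), (2,1), (3,1), (6,3), (3,1), (2,1), (1,0), (3,2), (4,2), (2,1), (3,1), (6,3),
   (3,1), (1,1), (2,1), (3,1), (4,2), (2,1), (3,1), (6,3), (3,1), (2,1), (2,1)]

/-- The distance from the nonzero letter number `n - 1` to the nonzero letter number `n`. -/
def gap (n : ℕ) : ℕ × ℕ :=
  -- The initial gap is `a`. The other two gaps of `v` equal the last two of a block, so the cycle
  -- covers them; the offset `33` makes letter number `4` the first of a block.
  if n = 1 then (9, 4) else gapCycle.getD ((n + 33) % 37) (0, 0)

/-- The nonzero letter number `n`, where `3` stands for a letter that is at least `2`, and `0`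
for the beginning of the word. -/
def mark (n : ℕ) : ℕ :=
  -- Letter number `3` ends `v` and is a `1`, although its residue is that of the last letters of
  -- blocks.
  if n = 0 then 0 else if n = 3 then 1 else
    if (n + 33) % 37 = 30 then 2 else if (n + 33) % 37 = 36 then 3 else 1

/-- The sum of the `e` gaps that follow the nonzero letter number `n`. -/
def span (n : ℕ) : ℕ → ℕ × ℕ
  | 0 => (0, 0)
  | e + 1 => span n e + gap (n + e + 1)

/-- The position (counted from `1`) of the nonzero letter number `n`. -/
def place (p q n : ℕ) : ℕ := formVal p q (span 0 n)

theorem place_zero (p q : ℕ) : place p q 0 = 0 := by simp [place, span, formVal]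

theorem place_succ (p q n : ℕ) : place p q (n + 1) = place p q n + formVal p q (gap (n + 1)) := by
  simp [place, span, formVal_add]

theorem place_add (p q n e : ℕ) : place p q (n + e) = place p q n + formVal p q (span n e) := by
  induction e with
  | zero => simp [span, formVal]
  | succ e ih => rw [← add_assoc, place_succ, ih, span, formVal_add, add_assoc]

theorem gap_add_period {n : ℕ} (hn : 2 ≤ n) : gap (n + 37) = gap n := by
  unfold gap
  rw [if_neg (by omega), if_neg (by omega), show n + 37 + 33 = n + 33 + 37 by ring,
    Nat.add_mod_right]

theorem mark_add_period {n : ℕ} (hn : 4 ≤ n) : mark (n + 37) = mark n := by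
  unfold mark
  rw [if_neg (show n + 37 ≠ 0 by omega), if_neg (show n + 37 ≠ 3 by omega),
    if_neg (show n ≠ 0 by omega), if_neg (show n ≠ 3 by omega),
    show n + 37 + 33 = n + 33 + 37 by ring, Nat.add_mod_right]

theorem span_add_period {n : ℕ} (hn : 1 ≤ n) (e : ℕ) : span (n + 37) e = span n e := by
  induction e with
  | zero => rfl
  | succ e ih => rw [span, span, ih, show n + 37 + e + 1 = n + e + 1 + 37 by ring,
      gap_add_period (by omega)]

theorem span_period {n : ℕ} (hn : 1 ≤ n) : span n 37 = (111, 51) := by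
  have base : ∀ m < 38, span (m + 1) 37 = (111, 51) := by decide +kernel
  induction n using Nat.strong_induction_on with
  | _ n ih =>
    by_cases h : n < 38
    · obtain ⟨m, rfl⟩ : ∃ m, n = m + 1 := ⟨n - 1, by omega⟩
      exact base m (by omega)
    · obtain ⟨m, rfl⟩ : ∃ m, n = m + 37 := ⟨n - 37, by omega⟩
      rw [span_add_period (by omega), ih m (by omega) (by omega)]

theorem place_add_period (p q : ℕ) {n : ℕ} (hn : 1 ≤ n) :
    place p q (n + 37) = place p q n + (111 * p + 51 * q) := by
  rw [place_add, span_period hn, formVal]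

theorem place_add_mul_period (p q : ℕ) {n : ℕ} (hn : 1 ≤ n) (u : ℕ) :
    place p q (n + 37 * u) = place p q n + (111 * p + 51 * q) * u := by
  induction u with
  | zero => simp
  | succ u ih =>
    rw [show n + 37 * (u + 1) = n + 37 * u + 37 by ring, place_add_period p q (by omega), ih]
    ring

theorem one_le_gap (n : ℕ) : 1 ≤ (gap n).1 := by
  unfold gap
  split_ifs with h
  · norm_num
  · have : ∀ r < 37, 1 ≤ (gapCycle.getD r (0, 0)).1 := by decide
    exact this _ (Nat.mod_lt _ (by norm_num))

/-- Since `(6, 3)` stands for `3 (a - b)`, only the initial run of zeros can contain a window with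
`m ≥ 3`. -/
theorem gap_le {n : ℕ} (hn : n ≠ 1) : formLe (gap n) (6, 3) = true := by
  unfold gap
  rw [if_neg hn]
  have : ∀ r < 37, formLe (gapCycle.getD r (0, 0)) (6, 3) = true := by decide
  exact this _ (Nat.mod_lt _ (by norm_num))

theorem formVal_gap_pos {p : ℕ} (q : ℕ) (hp : 0 < p) (n : ℕ) : 0 < formVal p q (gap n) := by
  have := one_le_gap n
  unfold formVal
  positivity

theorem place_strictMono {p q : ℕ} (hp : 0 < p) : StrictMono (place p q) :=
  strictMono_nat_of_lt_succ fun n => by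
    rw [place_succ]
    have := formVal_gap_pos q hp (n + 1)
    omega

/-- The word `W`, counted from position `1`, has its nonzero letters at the positions
`place p q n` with `n ≥ 1`, and these letters are described by `mark n`. -/
structure IsMarked (p q : ℕ) (W : ℕ → ℕ) : Prop where
  one : ∀ n, mark n = 1 → W (place p q n) = 1
  two : ∀ n, mark n = 2 → W (place p q n) = 2
  three : ∀ n, mark n = 3 → 2 ≤ W (place p q n)
  zero : ∀ n x, place p q n < x → x < place p q (n + 1) → W x = 0

theorem mark_cases {n : ℕ} (hn : 1 ≤ n) : mark n = 1 ∨ mark n = 2 ∨ mark n = 3 := by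
  unfold mark
  rw [if_neg (by omega)]
  split_ifs <;> simp

theorem IsMarked.ne_zero {p q : ℕ} {W : ℕ → ℕ} (hW : IsMarked p q W) {n : ℕ} (hn : 1 ≤ n) :
    W (place p q n) ≠ 0 := by
  rcases mark_cases hn with h | h | h
  · rw [hW.one n h]; norm_num
  · rw [hW.two n h]; norm_num
  · have := hW.three n h; omega

theorem exists_place_lt {p q : ℕ} (hp : 0 < p) {x : ℕ} (hx : 1 ≤ x) :
    ∃ n, place p q n < x ∧ x ≤ place p q (n + 1) := by
  have h1 : ∃ n, x ≤ place p q n := ⟨x, (place_strictMono hp).id_le x⟩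
  classical
  have h2 := Nat.find_spec h1
  have h3 : Nat.find h1 ≠ 0 := by
    intro h
    rw [h, place_zero] at h2
    omega
  obtain ⟨n, hn⟩ := Nat.exists_eq_succ_of_ne_zero h3
  refine ⟨n, ?_, ?_⟩
  · have := Nat.find_min h1 (m := n) (by omega)
    omega
  · rwa [hn] at h2

theorem IsMarked.exists_place {p q : ℕ} {W : ℕ → ℕ} (hW : IsMarked p q W) (hp : 0 < p) {x : ℕ}
    (hx : 1 ≤ x) (h : W x ≠ 0) : ∃ n, 1 ≤ n ∧ x = place p q n := by
  obtain ⟨n, h1, h2⟩ := exists_place_lt (q := q) hp hx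
  refine ⟨n + 1, by omega, ?_⟩
  by_contra h3
  exact h (hW.zero n x h1 (by omega))

/-! ### How far two occurrences of nonzero letters agree -/

/-- Exactly one of the nonzero letters number `n` and `n'` is a `1`. -/
def marksDiffer (n n' : ℕ) : Bool := Nat.beq (mark n) 1 != Nat.beq (mark n') 1

/-- Marks `2` and `3` are not told apart, because a letter with mark `3` may itself be `2`. -/
theorem IsMarked.ne_of_marksDiffer {p q : ℕ} {W : ℕ → ℕ} (hW : IsMarked p q W) {n n' : ℕ}
    (hn : 1 ≤ n) (hn' : 1 ≤ n') (h : marksDiffer n n' = true) :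
    W (place p q n) ≠ W (place p q n') := by
  have key : ∀ m, 1 ≤ m → (Nat.beq (mark m) 1 = true ↔ W (place p q m) = 1) := by
    intro m hm
    rw [Nat.beq_eq]
    refine ⟨hW.one m, fun h1 => ?_⟩
    rcases mark_cases hm with h | h | h
    · exact h
    · have := hW.two m h; omega
    · have := hW.three m h; omega
  intro he
  have h1 := key n hn
  have h2 := key n' hn'
  rw [he] at h1
  unfold marksDiffer at h
  have h3 : Nat.beq (mark n) 1 = Nat.beq (mark n') 1 := by
    rw [Bool.eq_iff_iff, h1, h2]
  rw [h3] at h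
  simp at h

/-- The smaller of two distinct forms, if they are comparable. -/
def formMin (x y : ℕ × ℕ) : Option (ℕ × ℕ) :=
  bif formLt x y then some x else bif formLt y x then some y else none

/-- A bound for the length of the agreement to the right of the nonzero letters number `n`
and `n'`. -/
def reachRight : ℕ → ℕ → ℕ → Option (ℕ × ℕ)
  | 0, _, _ => none
  | f + 1, n, n' =>
    bif formEq (gap (n + 1)) (gap (n' + 1)) then
      bif marksDiffer (n + 1) (n' + 1) then some (gap (n + 1))
      else (reachRight f (n + 1) (n' + 1)).map fun r => gap (n + 1) + r
    else formMin (gap (n + 1)) (gap (n' + 1))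

/-- A bound for the length of the agreement to the left of the nonzero letters number `n`
and `n'`. -/
def reachLeft : ℕ → ℕ → ℕ → Option (ℕ × ℕ)
  | f + 1, n + 1, n' + 1 =>
    bif formEq (gap (n + 1)) (gap (n' + 1)) then
      bif marksDiffer n n' then some (gap (n + 1))
      else (reachLeft f n n').map fun r => gap (n + 1) + r
    else formMin (gap (n + 1)) (gap (n' + 1))
  | _, _, _ => none

theorem formMin_cases {x y r : ℕ × ℕ} {p q : ℕ} (hp : 0 < p) (hq : 0 < q)
    (h : formMin x y = some r) : (r = x ∧ formVal p q x < formVal p q y) ∨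
      (r = y ∧ formVal p q y < formVal p q x) := by
  unfold formMin at h
  cases h1 : formLt x y with
  | true =>
    rw [h1] at h
    left
    exact ⟨by simpa using h.symm, formVal_lt hp hq h1⟩
  | false =>
    cases h2 : formLt y x with
    | true =>
      rw [h1, h2] at h
      right
      exact ⟨by simpa using h.symm, formVal_lt hp hq h2⟩
    | false => simp [h1, h2] at h

/-- While gaps and marks match, the comparison moves on by one letter. At the first pair of unequal
gaps the nearer nonzero letter faces a zero; which one is nearer must not depend on `p` and `q`, so
incomparable gaps give `none`. -/
theorem IsMarked.lt_of_reachRight {p q : ℕ} {W : ℕ → ℕ} (hW : IsMarked p q W) (hp : 0 < p)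
    (hq : 0 < q) (f : ℕ) : ∀ (n n' T : ℕ) (r : ℕ × ℕ), reachRight f n n' = some r →
      (∀ t ≤ T, W (place p q n + t) = W (place p q n' + t)) → T < formVal p q r := by
  induction f with
  | zero => intro n n' T r h; simp [reachRight] at h
  | succ f ih =>
    intro n n' T r h hT
    have e1 := place_succ p q n
    have e2 := place_succ p q n'
    have g1 := formVal_gap_pos q hp (n + 1)
    have g2 := formVal_gap_pos q hp (n' + 1)
    rw [reachRight] at h
    cases h1 : formEq (gap (n + 1)) (gap (n' + 1)) with
    | false =>
      rw [h1, cond_false] at h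
      by_contra hlt
      rcases formMin_cases hp hq h with ⟨rfl, h3⟩ | ⟨rfl, h3⟩
      · have h4 := hT (formVal p q (gap (n + 1))) (by omega)
        rw [← e1, hW.zero n' (place p q n' + formVal p q (gap (n + 1))) (by omega) (by omega)]
          at h4
        exact hW.ne_zero (by omega) h4
      · have h4 := hT (formVal p q (gap (n' + 1))) (by omega)
        rw [← e2, hW.zero n (place p q n + formVal p q (gap (n' + 1))) (by omega) (by omega)]
          at h4
        exact hW.ne_zero (by omega) h4.symm
    | true =>
      rw [h1, cond_true] at h
      rw [formEq_iff] at h1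
      cases h2 : marksDiffer (n + 1) (n' + 1) with
      | true =>
        rw [h2, cond_true, Option.some.injEq] at h
        subst h
        by_contra hlt
        have h4 := hT (formVal p q (gap (n + 1))) (by omega)
        rw [← e1, h1, ← e2] at h4
        exact hW.ne_of_marksDiffer (by omega) (by omega) h2 h4
      | false =>
        rw [h2, cond_false, Option.map_eq_some_iff] at h
        obtain ⟨r', hr', rfl⟩ := h
        rw [formVal_add]
        by_cases hlt : T < formVal p q (gap (n + 1))
        · omega
        · have := ih (n + 1) (n' + 1) (T - formVal p q (gap (n + 1))) r' hr' (fun t ht => by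
            have := hT (formVal p q (gap (n + 1)) + t) (by omega)
            rwa [← add_assoc, ← add_assoc, ← e1, h1, ← e2] at this)
          omega

/-- Mirror image of the comparison to the right. The condition `T < place p q n` keeps the window
inside the word, so that number `0`, which is no letter, never takes part. -/
theorem IsMarked.lt_of_reachLeft {p q : ℕ} {W : ℕ → ℕ} (hW : IsMarked p q W) (hp : 0 < p)
    (hq : 0 < q) (f : ℕ) : ∀ (n n' T : ℕ) (r : ℕ × ℕ), n < n' → reachLeft f n n' = some r →
      (∀ t ≤ T, W (place p q n - t) = W (place p q n' - t)) → T < place p q n →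
      T < formVal p q r := by
  induction f with
  | zero => intro n n' T r _ h; simp [reachLeft] at h
  | succ f ih =>
    intro n n' T r hn h hT hTn
    obtain _ | n := n
    · simp [reachLeft] at h
    obtain _ | n' := n'
    · omega
    have e1 := place_succ p q n
    have e2 := place_succ p q n'
    have g1 := formVal_gap_pos q hp (n + 1)
    have g2 := formVal_gap_pos q hp (n' + 1)
    have hpos : place p q n < place p q n' := place_strictMono hp (by omega)
    rw [reachLeft] at h
    have hn1 : formVal p q (gap (n + 1)) ≤ T → 1 ≤ n := by
      intro h5
      by_contra h6
      obtain rfl : n = 0 := by omega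
      rw [place_zero] at e1
      omega
    cases h1 : formEq (gap (n + 1)) (gap (n' + 1)) with
    | false =>
      rw [h1, cond_false] at h
      by_contra hlt
      rcases formMin_cases hp hq h with ⟨rfl, h3⟩ | ⟨rfl, h3⟩
      · have h4 := hT (formVal p q (gap (n + 1))) (by omega)
        rw [hW.zero n' (place p q (n' + 1) - formVal p q (gap (n + 1))) (by omega) (by omega),
          e1, Nat.add_sub_cancel] at h4
        exact hW.ne_zero (hn1 (by omega)) h4
      · have h4 := hT (formVal p q (gap (n' + 1))) (by omega)
        rw [hW.zero n (place p q (n + 1) - formVal p q (gap (n' + 1))) (by omega) (by omega),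
          e2, Nat.add_sub_cancel] at h4
        exact hW.ne_zero (by omega) h4.symm
    | true =>
      rw [h1, cond_true] at h
      rw [formEq_iff] at h1
      cases h2 : marksDiffer n n' with
      | true =>
        rw [h2, cond_true, Option.some.injEq] at h
        subst h
        by_contra hlt
        have h4 := hT (formVal p q (gap (n + 1))) (by omega)
        rw [e1, Nat.add_sub_cancel, h1, e2, Nat.add_sub_cancel] at h4
        exact hW.ne_of_marksDiffer (hn1 (by omega)) (by omega) h2 h4
      | false =>
        rw [h2, cond_false, Option.map_eq_some_iff] at h
        obtain ⟨r', hr', rfl⟩ := h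
        rw [formVal_add]
        by_cases hlt : T < formVal p q (gap (n + 1))
        · omega
        · have := ih n n' (T - formVal p q (gap (n + 1))) r' (by omega) hr' (fun t ht => by
            have := hT (formVal p q (gap (n + 1)) + t) (by omega)
            rwa [show place p q (n + 1) - (formVal p q (gap (n + 1)) + t) = place p q n - t by
              omega, show place p q (n' + 1) - (formVal p q (gap (n + 1)) + t) =
              place p q n' - t by rw [h1]; omega] at this)
            (by omega)
          omega

theorem marksDiffer_add_left {n : ℕ} (hn : 4 ≤ n) (n' : ℕ) :
    marksDiffer (n + 37) n' = marksDiffer n n' := by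
  rw [marksDiffer, mark_add_period hn, marksDiffer]

theorem marksDiffer_add_right {n' : ℕ} (hn' : 4 ≤ n') (n : ℕ) :
    marksDiffer n (n' + 37) = marksDiffer n n' := by
  rw [marksDiffer, mark_add_period hn', marksDiffer]

theorem reachRight_add_left (f : ℕ) : ∀ {n : ℕ}, 4 ≤ n → ∀ n', reachRight f (n + 37) n' =
    reachRight f n n' := by
  induction f with
  | zero => intro n _ n'; rfl
  | succ f ih =>
    intro n hn n'
    rw [reachRight, reachRight, show n + 37 + 1 = n + 1 + 37 by ring, gap_add_period (by omega),
      marksDiffer_add_left (by omega), ih (by omega)]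

theorem reachRight_add_right (f : ℕ) : ∀ {n' : ℕ}, 4 ≤ n' → ∀ n, reachRight f n (n' + 37) =
    reachRight f n n' := by
  induction f with
  | zero => intro n _ n'; rfl
  | succ f ih =>
    intro n' hn n
    rw [reachRight, reachRight, show n' + 37 + 1 = n' + 1 + 37 by ring,
      gap_add_period (by omega), marksDiffer_add_right (by omega), ih (by omega)]

theorem reachLeft_add_left (f : ℕ) : ∀ {n : ℕ}, f + 4 ≤ n → ∀ n', reachLeft f (n + 37) n' =
    reachLeft f n n' := by
  induction f with
  | zero => intro n _ n'; rfl
  | succ f ih =>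
    intro n hn n'
    obtain ⟨n, rfl⟩ : ∃ m, n = m + 1 := ⟨n - 1, by omega⟩
    obtain _ | n' := n'
    · rfl
    rw [show n + 1 + 37 = n + 37 + 1 by ring, reachLeft, reachLeft,
      show n + 37 + 1 = n + 1 + 37 by ring, gap_add_period (by omega),
      marksDiffer_add_left (by omega), ih (by omega)]

theorem reachLeft_add_right (f : ℕ) : ∀ {n' : ℕ}, f + 4 ≤ n' → ∀ n, reachLeft f n (n' + 37) =
    reachLeft f n n' := by
  induction f with
  | zero => intro n _ n'; rfl
  | succ f ih =>
    intro n' hn n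
    obtain ⟨n', rfl⟩ : ∃ m, n' = m + 1 := ⟨n' - 1, by omega⟩
    obtain _ | n := n
    · rfl
    rw [show n' + 1 + 37 = n' + 37 + 1 by ring, reachLeft, reachLeft,
      show n' + 37 + 1 = n' + 1 + 37 by ring, gap_add_period (by omega),
      marksDiffer_add_right (by omega), ih (by omega)]

/-- A bound for the length of a common window around the nonzero letters number `n` and `n'`. -/
def reach (n n' : ℕ) : Option (ℕ × ℕ) :=
  bif marksDiffer n n' then some (0, 0)
  else (reachRight 8 n n').bind fun x => (reachLeft 8 n n').map fun y => x + y

theorem reach_add_left {n : ℕ} (hn : 12 ≤ n) (n' : ℕ) : reach (n + 37) n' = reach n n' := by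
  rw [reach, reach, marksDiffer_add_left (by omega), reachRight_add_left _ (by omega),
    reachLeft_add_left _ (by omega)]

theorem reach_add_right {n' : ℕ} (hn : 12 ≤ n') (n : ℕ) : reach n (n' + 37) = reach n n' := by
  rw [reach, reach, marksDiffer_add_right (by omega), reachRight_add_right _ (by omega),
    reachLeft_add_right _ (by omega)]

/-- The common letter splits the window: it extends less than `y` to the left and less than `x` to
the right, hence has fewer than `x + y` letters. -/
theorem IsMarked.lt_reach {p q : ℕ} {W : ℕ → ℕ} (hW : IsMarked p q W) (hp : 0 < p) (hq : 0 < q)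
    {n n' i d L : ℕ} {r : ℕ × ℕ} (hn : 1 ≤ n) (hnn : n < n') (hr : reach n n' = some r)
    (hd : place p q n' = place p q n + d) (hi : 1 ≤ i) (h1 : i ≤ place p q n)
    (h2 : place p q n < i + L) (hL : ∀ j < L, W (i + j) = W (i + j + d)) :
    L < formVal p q r := by
  unfold reach at hr
  cases hm : marksDiffer n n' with
  | true =>
    exfalso
    apply hW.ne_of_marksDiffer hn (by omega) hm
    have := hL (place p q n - i) (by omega)
    rwa [Nat.add_sub_cancel' h1, ← hd] at this
  | false =>
    rw [hm, cond_false, Option.bind_eq_some_iff] at hr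
    obtain ⟨x, hx, hr⟩ := hr
    rw [Option.map_eq_some_iff] at hr
    obtain ⟨y, hy, rfl⟩ := hr
    have k1 := hW.lt_of_reachRight hp hq 8 n n' (i + L - 1 - place p q n) x hx (fun t ht => by
      have := hL (place p q n + t - i) (by omega)
      rwa [Nat.add_sub_cancel' (by omega), add_right_comm, ← hd] at this)
    have k2 := hW.lt_of_reachLeft hp hq 8 n n' (place p q n - i) y hnn hy (fun t ht => by
      have := hL (place p q n - t - i) (by omega)
      rwa [Nat.add_sub_cancel' (by omega), show place p q n - t + d = place p q n' - t by omega]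
        at this) (by omega)
    rw [formVal_add]
    omega

/-- No window of length `m (2 p + q)` around the nonzero letter number `n` agrees with the window
shifted by `m (7 p + 3 q)` to the nonzero letter number `n + e`, unless `p = q`. -/
def reachCheck (n e : ℕ) : Bool :=
  Nat.beq (e % 37) 0 ||
  (reach n (n + e)).any fun r => formLe r (18, 9) &&
    Nat.all 9 fun m _ => formLe r (2 * m, m) ||
      formLt (7 * m, 3 * m) (span n e) || formLt (span n e) (7 * m, 3 * m) ||
      -- Here the distance form is `(7m - 1, 3m + 1)`, incomparable with `(7m, 3m)`; the values
      -- coincide only for `p = q`.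
      formEq (span n e + (1, 0)) ((7 * m, 3 * m) + (0, 1))

/-- The table suffices because `reach` is periodic in each index from `12` on: it looks back at most
`8` letters, and the marks are periodic from number `4` on. -/
theorem reachCheck_table : Nat.all 49 (fun n _ => Nat.all 50 fun e _ =>
    reachCheck (n + 1) (e + 1)) = true := by
  decide +kernel

theorem natAll_iff {n : ℕ} {f : (i : ℕ) → i < n → Bool} :
    Nat.all n f = true ↔ ∀ i (h : i < n), f i h = true := by
  induction n with
  | zero => simp [Nat.all]
  | succ n ih =>
    rw [Nat.all, Bool.and_eq_true, ih]
    refine ⟨fun h i hi => ?_, fun h => ⟨fun i hi => h i (by omega), h n (by omega)⟩⟩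
    rcases Nat.lt_succ_iff_lt_or_eq.1 hi with h1 | rfl
    · exact h.1 i h1
    · exact h.2

theorem reachCheck_add {n : ℕ} (hn : 12 ≤ n) (e : ℕ) :
    reachCheck (n + 37) e = reachCheck n e := by
  rw [reachCheck, reachCheck, show n + 37 + e = n + e + 37 by ring, reach_add_left hn,
    reach_add_right (by omega), span_add_period (by omega)]

theorem reachCheck_of_le {n e : ℕ} (hn : 1 ≤ n) (he : 1 ≤ e) (he' : e ≤ 50) :
    reachCheck n e = true := by
  induction n using Nat.strong_induction_on with
  | _ n ih =>
    by_cases h : n ≤ 49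
    · have h1 := natAll_iff.1 (natAll_iff.1 reachCheck_table (n - 1) (by omega)) (e - 1) (by omega)
      rwa [Nat.sub_add_cancel hn, Nat.sub_add_cancel he] at h1
    · obtain ⟨m, rfl⟩ : ∃ m, n = m + 37 := ⟨n - 37, by omega⟩
      rw [reachCheck_add (by omega)]
      exact ih m (by omega) (by omega)

theorem exists_reach {n e : ℕ} (hn : 1 ≤ n) (he : e % 37 ≠ 0) :
    ∃ r, reach n (n + e) = some r ∧ formLe r (18, 9) = true := by
  induction e using Nat.strong_induction_on with
  | _ e ih =>
    by_cases h : e ≤ 50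
    · have h1 := reachCheck_of_le hn (by omega) h
      rw [reachCheck, Bool.or_eq_true, Nat.beq_eq] at h1
      have h2 := h1.resolve_left he
      rw [Option.any_eq_true] at h2
      obtain ⟨r, hr, h3⟩ := h2
      rw [Bool.and_eq_true] at h3
      exact ⟨r, hr, h3.1⟩
    · obtain ⟨m, rfl⟩ : ∃ m, e = m + 37 := ⟨e - 37, by omega⟩
      rw [← add_assoc, reach_add_right (by omega)]
      exact ih m (by omega) (by omega)

theorem IsMarked.dvd_of_agree_of_place {p q : ℕ} {W : ℕ → ℕ} (hW : IsMarked p q W) (hp : 0 < p)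
    (hq : 0 < q) (hpq : p ≠ q) {n i m : ℕ} (hn : 1 ≤ n) (hi : 1 ≤ i)
    (h1 : i ≤ place p q n) (h2 : place p q n < i + m * (2 * p + q))
    (hL : ∀ j < m * (2 * p + q), W (i + j) = W (i + j + m * (7 * p + 3 * q))) :
    111 * p + 51 * q ∣ m * (7 * p + 3 * q) := by
  have hm : m ≠ 0 := by rintro rfl; omega
  have hne : W (place p q n + m * (7 * p + 3 * q)) ≠ 0 := by
    have h := hL (place p q n - i) (by omega)
    rw [Nat.add_sub_cancel' h1] at h
    rw [← h]
    exact hW.ne_zero hn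
  have hd : 0 < m * (7 * p + 3 * q) := by positivity
  obtain ⟨n', hn', hd'⟩ := hW.exists_place hp (by omega) hne
  have hlt : n < n' := (place_strictMono (q := q) hp).lt_iff_lt.1 (by omega)
  obtain ⟨e, rfl⟩ : ∃ e, n' = n + e := ⟨n' - n, by omega⟩
  have hspan := place_add p q n e
  -- Letters whose numbers agree modulo `37` are a whole number of blocks apart, as desired. All
  -- other `e` are impossible.
  by_cases he : e % 37 = 0
  · obtain ⟨u, rfl⟩ := Nat.dvd_of_mod_eq_zero he
    rw [place_add_mul_period p q hn u] at hd'
    exact ⟨u, by omega⟩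
  exfalso
  obtain ⟨r, hr, hr'⟩ := exists_reach hn he
  have hlen := hW.lt_reach hp hq hn hlt hr hd'.symm hi h1 h2 hL
  have hle := formVal_le p q hr'
  -- The form `(18, 9)` is `9 (a - b)`.
  have hm8 : m < 9 := by
    by_contra h9
    have : 9 * (2 * p + q) ≤ m * (2 * p + q) := Nat.mul_le_mul_right _ (by omega)
    simp only [formVal] at hle hlen
    omega
  -- The distance is at most `8 b = 56 p + 24 q`, less than a block.
  have he37 : e < 37 := by
    by_contra h37
    have h3 : place p q (n + 37) ≤ place p q (n + e) :=
      (place_strictMono hp).monotone (by omega)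
    rw [place_add_period p q hn] at h3
    have : m * (7 * p + 3 * q) ≤ 8 * (7 * p + 3 * q) := Nat.mul_le_mul_right _ (by omega)
    omega
  have hcheck := reachCheck_of_le hn (show 1 ≤ e by omega) (by omega)
  rw [reachCheck, hr, Option.any_some, Bool.or_eq_true, Nat.beq_eq, Bool.and_eq_true] at hcheck
  have h5 := natAll_iff.1 (hcheck.resolve_left he).2 m hm8
  have h6 : formVal p q (7 * m, 3 * m) = m * (7 * p + 3 * q) := by simp only [formVal]; ring
  simp only [Bool.or_eq_true] at h5
  rcases h5 with ((h5 | h5) | h5) | h5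
  · have h7 := formVal_le p q h5
    have h8 : formVal p q (2 * m, m) = m * (2 * p + q) := by simp only [formVal]; ring
    omega
  · have := formVal_lt hp hq h5
    omega
  · have := formVal_lt hp hq h5
    omega
  · rw [formEq_iff] at h5
    have h7 := congrArg (formVal p q) h5
    rw [formVal_add, formVal_add, h6] at h7
    simp only [formVal] at h7 hspan
    omega

/-- Two windows of zeros of length `m (2 p + q)` are not at distance `m (7 p + 3 q)`. -/
def zeroCheck (n e : ℕ) : Bool :=
  Nat.all 2 fun m' _ =>
    formLe (gap (n + 1)) (2 * (m' + 1), m' + 1) || formLe (gap (n + e + 1)) (2 * (m' + 1), m' + 1) ||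
    formLe (gap (n + 1) + (5 * (m' + 1), 2 * (m' + 1))) (span n e) ||
    formLe (span n (e + 1)) (9 * (m' + 1), 4 * (m' + 1))

theorem zeroCheck_table : Nat.all 49 (fun n _ => Nat.all 9 fun e _ => zeroCheck n e) = true := by
  decide +kernel

theorem zeroCheck_of_le (n : ℕ) {e : ℕ} (he : e ≤ 8) : zeroCheck n e = true := by
  induction n using Nat.strong_induction_on with
  | _ n ih =>
    by_cases h : n < 49
    · exact natAll_iff.1 (natAll_iff.1 zeroCheck_table n h) e (by omega)
    · obtain ⟨m, rfl⟩ : ∃ m, n = m + 37 := ⟨n - 37, by omega⟩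
      rw [← ih m (by omega)]
      rw [zeroCheck, zeroCheck, span_add_period (by omega), span_add_period (by omega),
        show m + 37 + 1 = m + 1 + 37 by ring, show m + 37 + e + 1 = m + e + 1 + 37 by ring,
        gap_add_period (by omega), gap_add_period (by omega)]

/-- From the end of a window to the start of its copy there are `m (2b - a)` positions; `(10, 4)` is
this form for `m = 2`. -/
theorem formLe_span_seven : ∀ n, formLe (10, 4) (span (n + 1) 7) = true := by
  have base : Nat.all 38 (fun n _ => formLe (10, 4) (span (n + 1) 7)) = true := by decide +kernel
  intro n
  induction n using Nat.strong_induction_on with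
  | _ n ih =>
    by_cases h : n < 38
    · exact natAll_iff.1 base n h
    · obtain ⟨m, rfl⟩ : ∃ m, n = m + 37 := ⟨n - 37, by omega⟩
      rw [show m + 37 + 1 = m + 1 + 37 by ring, span_add_period (by omega)]
      exact ih m (by omega)

theorem exists_window_place {p q : ℕ} (hp : 0 < p) {i L : ℕ} (hi : 1 ≤ i) :
    ∃ n, place p q n < i ∧ i ≤ place p q (n + 1) ∧
      ((∃ n', 1 ≤ n' ∧ i ≤ place p q n' ∧ place p q n' < i + L) ∨
        i + L ≤ place p q (n + 1)) := by
  obtain ⟨n, h1, h2⟩ := exists_place_lt (q := q) hp hi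
  refine ⟨n, h1, h2, ?_⟩
  by_cases h : i + L ≤ place p q (n + 1)
  · exact Or.inr h
  · exact Or.inl ⟨n + 1, by omega, h2, by omega⟩

/-- A window with a nonzero letter is covered by `IsMarked.dvd_of_agree_of_place`. Otherwise the
window and its copy lie in runs of zeros, which bounds `m` by `2` and the number of letters between
them; `zeroCheck` excludes what remains. -/
theorem IsMarked.dvd_of_agree {p q : ℕ} {W : ℕ → ℕ} (hW : IsMarked p q W) (hp : 0 < p)
    (hq : 0 < q) (hpq : p ≠ q) {i m : ℕ} (hm : 1 ≤ m) (hi : 1 ≤ i)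
    (hL : ∀ j < m * (2 * p + q), W (i + j) = W (i + j + m * (7 * p + 3 * q))) :
    111 * p + 51 * q ∣ m * (7 * p + 3 * q) := by
  obtain ⟨n, h1, h2, h3⟩ := exists_window_place (q := q) hp (L := m * (2 * p + q)) hi
  rcases h3 with ⟨n', hn', h3, h4⟩ | h3
  · exact hW.dvd_of_agree_of_place hp hq hpq hn' hi h3 h4 hL
  exfalso
  obtain ⟨n', k1, k2, k3⟩ := exists_window_place (q := q) hp (i := i + m * (7 * p + 3 * q))
    (L := m * (2 * p + q)) (by omega)
  have k4 : i + m * (7 * p + 3 * q) + m * (2 * p + q) ≤ place p q (n' + 1) := by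
    rcases k3 with ⟨n'', hn'', k3, k4⟩ | k3
    · exfalso
      have h5 := hL (place p q n'' - (i + m * (7 * p + 3 * q))) (by omega)
      rw [hW.zero n _ (by omega) (by omega)] at h5
      apply hW.ne_zero hn''
      rw [h5]
      congr 1
      omega
    · exact k3
  have hnn : n ≤ n' := by
    by_contra h
    have : place p q (n' + 1) ≤ place p q n := (place_strictMono hp).monotone (by omega)
    omega
  obtain ⟨e, rfl⟩ : ∃ e, n' = n + e := ⟨n' - n, by omega⟩
  have e1 := place_succ p q n
  have e2 := place_succ p q (n + e)
  have e3 := place_add p q n e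
  have e4 := place_add p q n (e + 1)
  rw [← add_assoc] at e4
  have hm2 : m ≤ 2 := by
    by_contra h
    have h5 : 3 * (2 * p + q) ≤ m * (2 * p + q) := Nat.mul_le_mul_right _ (by omega)
    by_cases h6 : n + e + 1 = 1
    · obtain ⟨rfl, rfl⟩ : n = 0 ∧ e = 0 := by omega
      have h7 : place p q (0 + 0 + 1) = 9 * p + 4 * q := by
        rw [e2]
        norm_num [place_zero, gap, formVal]
      have : 3 * (7 * p + 3 * q) ≤ m * (7 * p + 3 * q) := Nat.mul_le_mul_right _ (by omega)
      omega
    · have h7 := formVal_le p q (gap_le h6)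
      simp only [formVal] at h7 e2
      omega
  have he : e ≤ 8 := by
    by_contra h
    have h5 := formVal_le p q (formLe_span_seven n)
    have h6 := place_add p q (n + 1) 7
    have h7 : place p q (n + 1 + 7) ≤ place p q (n + e) :=
      (place_strictMono hp).monotone (by omega)
    have h8 : m * (5 * p + 2 * q) ≤ 2 * (5 * p + 2 * q) := Nat.mul_le_mul_right _ hm2
    have h9 : m * (7 * p + 3 * q) = m * (5 * p + 2 * q) + m * (2 * p + q) := by ring
    simp only [formVal] at h5 h6
    omega
  have hc := natAll_iff.1 (zeroCheck_of_le n he) (m - 1) (by omega)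
  rw [Nat.sub_add_cancel hm] at hc
  simp only [Bool.or_eq_true] at hc
  have v1 : formVal p q (2 * m, m) = m * (2 * p + q) := by simp only [formVal]; ring
  have v2 : formVal p q (5 * m, 2 * m) + m * (2 * p + q) = m * (7 * p + 3 * q) := by
    simp only [formVal]; ring
  have v3 : formVal p q (9 * m, 4 * m) = m * (7 * p + 3 * q) + m * (2 * p + q) := by
    simp only [formVal]; ring
  rcases hc with ((hc | hc) | hc) | hc
  all_goals have h5 := formVal_le p q hc
  · omega
  · omega
  · rw [formVal_add] at h5
    omega
  · omega

/-! ### Powers that are created by smaller letters -/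

/-- To the left of the nonzero letters number `n` and `n'`, the word agrees for less than `L - c`
letters. -/
def agreesLeft (L : ℕ × ℕ) : ℕ → ℕ → ℕ → ℕ × ℕ → Bool
  | f + 1, n + 1, n' + 1, c =>
    (formLe L (c + gap (n + 1)) && formLe L (c + gap (n' + 1))) ||
    (formEq (gap (n + 1)) (gap (n' + 1)) && Nat.beq (mark n) (mark n') &&
      (Nat.beq (mark n) 1 || Nat.beq (mark n) 2) && agreesLeft L f n n' (c + gap (n + 1)))
  | _, _, _, _ => false

theorem IsMarked.eq_of_mark {p q : ℕ} {W : ℕ → ℕ} (hW : IsMarked p q W) {n n' : ℕ}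
    (h : mark n = mark n') (h' : mark n = 1 ∨ mark n = 2) :
    W (place p q n) = W (place p q n') := by
  rcases h' with h1 | h1
  · rw [hW.one n h1, hW.one n' (h ▸ h1)]
  · rw [hW.two n h1, hW.two n' (h ▸ h1)]

/-- The accumulator `c` is the distance already compared. Only marks `1` and `2` allow a step past a
letter, because letters of mark `3` may differ. -/
theorem IsMarked.eq_of_agreesLeft {p q : ℕ} {W : ℕ → ℕ} (hW : IsMarked p q W) (L : ℕ × ℕ)
    (f : ℕ) : ∀ (n n' : ℕ) (c : ℕ × ℕ), agreesLeft L f n n' c = true → ∀ t, 0 < t →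
      formVal p q c + t < formVal p q L → W (place p q n - t) = W (place p q n' - t) := by
  induction f with
  | zero => intro n n' c h; simp [agreesLeft] at h
  | succ f ih =>
    intro n n' c h t ht htL
    obtain _ | n := n
    · simp [agreesLeft] at h
    obtain _ | n' := n'
    · simp [agreesLeft] at h
    have e1 := place_succ p q n
    have e2 := place_succ p q n'
    simp only [agreesLeft, Bool.or_eq_true, Bool.and_eq_true, formEq_iff, Nat.beq_eq] at h
    rcases h with ⟨h1, h2⟩ | ⟨⟨⟨h1, h2⟩, h3⟩, h4⟩
    · replace h1 := formVal_le p q h1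
      replace h2 := formVal_le p q h2
      rw [formVal_add] at h1 h2
      rw [hW.zero n _ (by omega) (by omega), hW.zero n' _ (by omega) (by omega)]
    · rw [← h1] at e2
      rcases lt_trichotomy t (formVal p q (gap (n + 1))) with h5 | h5 | h5
      · rw [hW.zero n _ (by omega) (by omega), hW.zero n' _ (by omega) (by omega)]
      · rw [h5, e1, e2, Nat.add_sub_cancel, Nat.add_sub_cancel]
        exact hW.eq_of_mark h2 h3
      · have h6 := ih n n' _ h4 (t - formVal p q (gap (n + 1))) (by omega) (by
          rw [formVal_add]; omega)
        rwa [show place p q (n + 1) - t = place p q n - (t - formVal p q (gap (n + 1))) by omega,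
          show place p q (n' + 1) - t = place p q n' - (t - formVal p q (gap (n + 1))) by omega]

/-- A change of the nonzero letter number `n' + e + 1` to `0` creates a power with the length
parameter `m`, whose period begins between the nonzero letters number `n'` and `n' + 1`. -/
def zeroWitness (n' e m : ℕ) : Bool :=
  formLt (7 * m, 3 * m) (span n' (e + 1)) && formLt (span (n' + 1) e) (7 * m, 3 * m) &&
  ((formLe (2 * m, m) (gap (n' + e + 1)) &&
      formLe ((7 * m, 3 * m) + (2 * m, m)) (span n' (e + 1))) ||
    (formEq (span n' e) (7 * m, 3 * m) &&
      Nat.beq (mark (n' + e)) (mark n') && (Nat.beq (mark n') 1 || Nat.beq (mark n') 2) &&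
      agreesLeft (2 * m, m) 4 (n' + e) n' (gap (n' + e + 1))))

/-- A change of the nonzero letter number `n' + e` to `1` creates a power with the length
parameter `m`, whose period begins at the nonzero letter number `n'`. -/
def oneWitness (n' e m : ℕ) : Bool :=
  formEq (span n' e) (7 * m, 3 * m) && Nat.beq (mark n') 1 &&
    agreesLeft (2 * m, m) 4 (n' + e) n' (0, 0)

/-- The letter number `x` of `W` can be changed to `c` only by creating a power with the length
parameter `m`. -/
def Blocks (p q : ℕ) (W : ℕ → ℕ) (x c m : ℕ) : Prop :=
  1 ≤ m ∧ m * (9 * p + 4 * q) ≤ x ∧ W (x - m * (7 * p + 3 * q)) = c ∧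
    ∀ t, 0 < t → t < m * (2 * p + q) → W (x - t) = W (x - m * (7 * p + 3 * q) - t)

/-- The position at distance `m b` lies strictly between two nonzero letters, hence carries `0`. To
its left either both windows are all zeros, or the letters `n' + e` and `n'` are exactly `m b` apart
and the comparison continues from them. -/
theorem IsMarked.blocks_zero {p q : ℕ} {W : ℕ → ℕ} (hW : IsMarked p q W) (hp : 0 < p)
    (hq : 0 < q) {n' e m : ℕ} (hm : 1 ≤ m) (h : zeroWitness n' e m = true)
    (hx : m * (9 * p + 4 * q) ≤ place p q (n' + e + 1)) :
    Blocks p q W (place p q (n' + e + 1)) 0 m := by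
  have e1 := place_add p q n' (e + 1)
  have e2 := place_add p q (n' + 1) e
  have e3 := place_succ p q (n' + e)
  rw [← add_assoc] at e1
  rw [show n' + 1 + e = n' + e + 1 by ring] at e2
  have e4 := place_add p q n' e
  simp only [zeroWitness, Bool.or_eq_true, Bool.and_eq_true, formEq_iff, Nat.beq_eq] at h
  obtain ⟨⟨h1, h2⟩, h3⟩ := h
  replace h1 := formVal_lt hp hq h1
  replace h2 := formVal_lt hp hq h2
  have v1 : formVal p q (2 * m, m) = m * (2 * p + q) := by simp only [formVal]; ring
  have v2 : formVal p q (7 * m, 3 * m) = m * (7 * p + 3 * q) := by simp only [formVal]; ring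
  refine ⟨hm, hx, hW.zero n' _ (by omega) (by omega), fun t ht htL => ?_⟩
  rcases h3 with ⟨h3, h4⟩ | ⟨⟨⟨h3, h4⟩, h5⟩, h6⟩
  · replace h3 := formVal_le p q h3
    replace h4 := formVal_le p q h4
    rw [formVal_add] at h4
    rw [hW.zero (n' + e) _ (by omega) (by omega), hW.zero n' _ (by omega) (by omega)]
  · rw [h3] at e4
    rcases lt_trichotomy t (formVal p q (gap (n' + e + 1))) with h7 | h7 | h7
    · rw [hW.zero (n' + e) _ (by omega) (by omega), hW.zero n' _ (by omega) (by omega)]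
    · rw [show place p q (n' + e + 1) - t = place p q (n' + e) by omega,
        show place p q (n' + e + 1) - m * (7 * p + 3 * q) - t = place p q n' by omega]
      exact hW.eq_of_mark h4 (by rwa [h4])
    · have h8 := hW.eq_of_agreesLeft _ _ _ _ _ h6 (t - formVal p q (gap (n' + e + 1)))
        (by omega) (by omega)
      rwa [show place p q (n' + e + 1) - t =
          place p q (n' + e) - (t - formVal p q (gap (n' + e + 1))) by omega,
        show place p q (n' + e + 1) - m * (7 * p + 3 * q) - t =
          place p q n' - (t - formVal p q (gap (n' + e + 1))) by omega]

theorem IsMarked.blocks_one {p q : ℕ} {W : ℕ → ℕ} (hW : IsMarked p q W) {n' e m : ℕ}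
    (hm : 1 ≤ m) (h : oneWitness n' e m = true)
    (hx : m * (9 * p + 4 * q) ≤ place p q (n' + e)) :
    Blocks p q W (place p q (n' + e)) 1 m := by
  simp only [oneWitness, Bool.and_eq_true, formEq_iff, Nat.beq_eq] at h
  obtain ⟨⟨h1, h2⟩, h3⟩ := h
  have e4 := place_add p q n' e
  have v1 : formVal p q (2 * m, m) = m * (2 * p + q) := by simp only [formVal]; ring
  have v2 : formVal p q (7 * m, 3 * m) = m * (7 * p + 3 * q) := by simp only [formVal]; ring
  have e5 : place p q (n' + e) - m * (7 * p + 3 * q) = place p q n' := by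
    rw [e4, h1, v2, Nat.add_sub_cancel]
  refine ⟨hm, hx, ?_, fun t ht htL => ?_⟩
  · rw [e5, hW.one n' h2]
  · rw [e5]
    exact hW.eq_of_agreesLeft _ _ _ _ _ h3 t ht (by rw [v1]; simpa [formVal] using htL)

theorem agreesLeft_add (L : ℕ × ℕ) (f : ℕ) : ∀ {n n' : ℕ}, f + 4 ≤ n → f + 4 ≤ n' →
    ∀ c, agreesLeft L f (n + 37) (n' + 37) c = agreesLeft L f n n' c := by
  induction f with
  | zero => intro n n' _ _ c; rfl
  | succ f ih =>
    intro n n' hn hn' c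
    obtain ⟨n, rfl⟩ : ∃ m, n = m + 1 := ⟨n - 1, by omega⟩
    obtain ⟨n', rfl⟩ : ∃ m, n' = m + 1 := ⟨n' - 1, by omega⟩
    rw [show n + 1 + 37 = n + 37 + 1 by ring, show n' + 1 + 37 = n' + 37 + 1 by ring, agreesLeft,
      agreesLeft, show n + 37 + 1 = n + 1 + 37 by ring, show n' + 37 + 1 = n' + 1 + 37 by ring,
      gap_add_period (by omega), gap_add_period (by omega), mark_add_period (by omega),
      mark_add_period (by omega), ih (by omega) (by omega)]

theorem zeroWitness_add {n' : ℕ} (hn' : 8 ≤ n') (e m : ℕ) :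
    zeroWitness (n' + 37) e m = zeroWitness n' e m := by
  rw [zeroWitness, zeroWitness, show n' + 37 + 1 = n' + 1 + 37 by ring,
    show n' + 37 + e + 1 = n' + e + 1 + 37 by ring, show n' + 37 + e = n' + e + 37 by ring,
    span_add_period (by omega), span_add_period (by omega), span_add_period (by omega),
    gap_add_period (by omega), mark_add_period (by omega), mark_add_period (by omega),
    agreesLeft_add _ _ (by omega) (by omega)]

theorem oneWitness_add {n' : ℕ} (hn' : 8 ≤ n') (e m : ℕ) :
    oneWitness (n' + 37) e m = oneWitness n' e m := by
  rw [oneWitness, oneWitness, show n' + 37 + e = n' + e + 37 by ring,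
    span_add_period (by omega), mark_add_period (by omega),
    agreesLeft_add _ _ (by omega) (by omega)]

/-- The change of the nonzero letter number `n` to `0`, and to `1` if it is larger than `1`,
creates powers. -/
def leastCheck (n : ℕ) : Bool :=
  (Nat.any 2 fun m _ => formLe (9 * (m + 1), 4 * (m + 1)) (span 0 n) &&
    Nat.any 6 fun e _ => Nat.ble (e + 1) n && zeroWitness (n - (e + 1)) e (m + 1)) &&
  (Nat.beq (mark n) 1 ||
    Nat.any 2 fun m _ => formLe (9 * (m + 1), 4 * (m + 1)) (span 0 n) &&
      Nat.any 6 fun e _ => Nat.ble (e + 1) n && oneWitness (n - (e + 1)) (e + 1) (m + 1))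

theorem leastCheck_table : Nat.all 50 (fun n _ => leastCheck (n + 1)) = true := by
  decide +kernel

theorem natAny_iff {n : ℕ} {f : (i : ℕ) → i < n → Bool} :
    Nat.any n f = true ↔ ∃ i, ∃ h : i < n, f i h = true := by
  induction n with
  | zero => simp [Nat.any]
  | succ n ih =>
    rw [Nat.any, Bool.or_eq_true, ih]
    constructor
    · rintro (⟨i, hi, h⟩ | h)
      · exact ⟨i, by omega, h⟩
      · exact ⟨n, by omega, h⟩
    · rintro ⟨i, hi, h⟩
      rcases Nat.lt_succ_iff_lt_or_eq.1 hi with h1 | rfl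
      · exact Or.inl ⟨i, h1, h⟩
      · exact Or.inr h

/-- Up to `n = 50` the table finds powers with `m ≤ 2`. Beyond that a witness for `n - 37` is
shifted by one period: its start is at least `8`, so four steps to the left stay in the periodic
range. -/
theorem exists_witness {p q : ℕ} (hp : 0 < p) {n : ℕ} (hn : 1 ≤ n) :
    (∃ n' e m, n = n' + e + 1 ∧ e < 6 ∧ 1 ≤ m ∧ m * (9 * p + 4 * q) ≤ place p q n ∧
      zeroWitness n' e m = true) ∧
    (mark n ≠ 1 → ∃ n' e m, n = n' + e ∧ e ≤ 6 ∧ 1 ≤ m ∧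
      m * (9 * p + 4 * q) ≤ place p q n ∧ oneWitness n' e m = true) := by
  have hform : ∀ m j, formLe (9 * (m + 1), 4 * (m + 1)) (span 0 j) = true →
      (m + 1) * (9 * p + 4 * q) ≤ place p q j := by
    intro m j h
    have := formVal_le p q h
    rw [place]
    refine le_trans (le_of_eq ?_) this
    simp only [formVal]; ring
  induction n using Nat.strong_induction_on with
  | _ n ih =>
    by_cases h : n ≤ 50
    · have h1 := natAll_iff.1 leastCheck_table (n - 1) (by omega)
      rw [Nat.sub_add_cancel hn, leastCheck, Bool.and_eq_true, Bool.or_eq_true, Nat.beq_eq] at h1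
      obtain ⟨h1, h2⟩ := h1
      constructor
      · obtain ⟨m, _, h1⟩ := natAny_iff.1 h1
        rw [Bool.and_eq_true] at h1
        obtain ⟨e, he, h3⟩ := natAny_iff.1 h1.2
        rw [Bool.and_eq_true, Nat.ble_eq] at h3
        exact ⟨n - (e + 1), e, m + 1, by omega, he, by omega, hform m n h1.1, h3.2⟩
      · intro hm
        obtain ⟨m, _, h1⟩ := natAny_iff.1 (h2.resolve_left hm)
        rw [Bool.and_eq_true] at h1
        obtain ⟨e, he, h3⟩ := natAny_iff.1 h1.2
        rw [Bool.and_eq_true, Nat.ble_eq] at h3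
        exact ⟨n - (e + 1), e + 1, m + 1, by omega, by omega, by omega, hform m n h1.1, h3.2⟩
    · obtain ⟨m, rfl⟩ : ∃ m, n = m + 37 := ⟨n - 37, by omega⟩
      have hle : place p q m ≤ place p q (m + 37) := (place_strictMono hp).monotone (by omega)
      obtain ⟨h1, h2⟩ := ih m (by omega) (by omega)
      rw [mark_add_period (by omega)]
      constructor
      · obtain ⟨n', e, l, h3, h4, h5, h6, h7⟩ := h1
        exact ⟨n' + 37, e, l, by omega, h4, h5, h6.trans hle, by
          rwa [zeroWitness_add (by omega)]⟩
      · intro hm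
        obtain ⟨n', e, l, h3, h4, h5, h6, h7⟩ := h2 hm
        exact ⟨n' + 37, e, l, by omega, h4, h5, h6.trans hle, by
          rwa [oneWitness_add (by omega)]⟩

/-! ### The self-similarity of the word -/

/-- A marked word that satisfies `W = v φ(W)`, where `v` has length `13 p + 6 q`. -/
structure IsSelfSimilar (p q : ℕ) (W : ℕ → ℕ) : Prop extends IsMarked p q W where
  periodic : ∀ x y r, 0 < r → r < 111 * p + 51 * q →
    W (13 * p + 6 * q + (111 * p + 51 * q) * x + r) =
      W (13 * p + 6 * q + (111 * p + 51 * q) * y + r)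
  last : ∀ x, 1 ≤ x → W (13 * p + 6 * q + (111 * p + 51 * q) * x) = W x + 2

theorem place_three (p q : ℕ) : place p q 3 = 13 * p + 6 * q := by
  have : span 0 3 = (13, 6) := by decide
  rw [place, this, formVal]

theorem IsSelfSimilar.exists_blocks {p q : ℕ} {W : ℕ → ℕ} (hW : IsSelfSimilar p q W)
    (hp : 0 < p) (hq : 0 < q) {x : ℕ} (hx : 1 ≤ x) :
    ∀ c < W x, ∃ m, Blocks p q W x c m := by
  induction x using Nat.strong_induction_on with
  | _ x ih =>
    intro c hc
    obtain ⟨n, hn, rfl⟩ := hW.exists_place hp hx (by omega)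
    obtain ⟨h1, h2⟩ := exists_witness (q := q) hp hn
    obtain _ | _ | c := c
    · obtain ⟨n', e, m, rfl, _, hm, h3, h4⟩ := h1
      exact ⟨m, hW.blocks_zero hp hq hm h4 h3⟩
    · obtain ⟨n', e, m, rfl, _, hm, h3, h4⟩ := h2 (fun h => by rw [hW.one n h] at hc; omega)
      exact ⟨m, hW.blocks_one hm h4 h3⟩
    -- A letter above `2` ends a block and equals `W y + 2`, so the power that blocks the value two
    -- smaller at `y` can be blown up by the factor `k`.
    · have h3 : mark n = 3 := by
        rcases mark_cases hn with h | h | h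
        · rw [hW.one n h] at hc; omega
        · rw [hW.two n h] at hc; omega
        · exact h
      obtain ⟨y, hy, rfl⟩ : ∃ y, 1 ≤ y ∧ n = 3 + 37 * y := by
        unfold mark at h3
        split_ifs at h3
        all_goals exact ⟨(n - 3) / 37, by omega, by omega⟩
      rw [place_add_mul_period p q (by omega), place_three] at hc ih ⊢
      set k := 111 * p + 51 * q with hk
      rw [hW.last y hy] at hc
      have hyk : y ≤ k * y := Nat.le_mul_of_pos_left _ (by omega)
      obtain ⟨m, hm, hmy, hc', hw⟩ := ih y (by omega) hy c (by omega)
      have e1 : m * (9 * p + 4 * q) = m * (7 * p + 3 * q) + m * (2 * p + q) := by ring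
      have e2 : 0 < m * (2 * p + q) := by positivity
      obtain ⟨z, hz⟩ : ∃ z, y = z + m * (7 * p + 3 * q) := ⟨y - m * (7 * p + 3 * q), by omega⟩
      have e3 : 13 * p + 6 * q + k * y - k * m * (7 * p + 3 * q) = 13 * p + 6 * q + k * z := by
        rw [hz, mul_add, mul_assoc]; omega
      refine ⟨k * m, Nat.mul_pos (by omega) hm, ?_, ?_, ?_⟩
      · rw [mul_assoc]
        have := Nat.mul_le_mul_left k hmy
        omega
      · rw [e3, hW.last z (by omega), ← hc', hz, Nat.add_sub_cancel]
      · intro t ht htk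
        rw [e3]
        rw [hz, Nat.add_sub_cancel] at hw
        have hkpos : 0 < k := by omega
        -- For `r = 0` last letters of blocks are compared, which is the agreement around `y`; for
        -- `r ≠ 0` both letters have the same place inside a block.
        obtain ⟨u, r, hr, rfl⟩ : ∃ u r, r < k ∧ t = k * u + r :=
          ⟨t / k, t % k, Nat.mod_lt _ hkpos, (Nat.div_add_mod t k).symm⟩
        have hu : u < m * (2 * p + q) := by
          rw [mul_assoc] at htk
          exact lt_of_mul_lt_mul_left (lt_of_le_of_lt (Nat.le_add_right _ _) htk) (Nat.zero_le k)
        obtain ⟨z', hz'⟩ : ∃ z', z = z' + u + 1 := ⟨z - u - 1, by omega⟩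
        rcases Nat.eq_zero_or_pos r with rfl | hr0
        · have hu0 : 0 < u := by
            rcases Nat.eq_zero_or_pos u with rfl | h
            · simp at ht
            · exact h
          have h4 := hw u hu0 hu
          rw [show 13 * p + 6 * q + k * y - (k * u + 0) =
              13 * p + 6 * q + k * (z + m * (7 * p + 3 * q) - u) by
            rw [hz, hz', show z' + u + 1 + m * (7 * p + 3 * q) - u =
              z' + 1 + m * (7 * p + 3 * q) by omega]
            ring_nf; omega,
            show 13 * p + 6 * q + k * z - (k * u + 0) = 13 * p + 6 * q + k * (z - u) by
            rw [hz', show z' + u + 1 - u = z' + 1 by omega]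
            ring_nf; omega, hW.last _ (by omega), hW.last _ (by omega), h4]
        · rw [show 13 * p + 6 * q + k * y - (k * u + r) =
              13 * p + 6 * q + k * (z' + m * (7 * p + 3 * q)) + (k - r) by
            rw [hz, hz']
            simp only [mul_add]
            omega,
            show 13 * p + 6 * q + k * z - (k * u + r) = 13 * p + 6 * q + k * z' + (k - r) by
            rw [hz']
            simp only [mul_add]
            omega]
          exact hW.periodic _ _ _ (by omega) (by omega)

theorem IsSelfSimilar.not_agree {p q : ℕ} {W : ℕ → ℕ} (hW : IsSelfSimilar p q W)
    (hp : 0 < p) (hq : 0 < q) (hpq : p ≠ q)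
    (hcop : Nat.Coprime (111 * p + 51 * q) (7 * p + 3 * q)) {m : ℕ} (hm : 1 ≤ m) :
    ∀ i, 1 ≤ i → ¬ ∀ j < m * (2 * p + q), W (i + j) = W (i + j + m * (7 * p + 3 * q)) := by
  induction m using Nat.strong_induction_on with
  | _ m ih =>
    intro i hi hL
    obtain ⟨m, rfl⟩ := hcop.dvd_of_dvd_mul_right (hW.dvd_of_agree hp hq hpq hm hi hL)
    set k := 111 * p + 51 * q with hk
    have hm1 : 1 ≤ m := Nat.pos_of_ne_zero (by rintro rfl; simp at hm)
    -- The first position `s + k x` in the window; the next ones of this form decode to the window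
    -- that starts at `x`.
    obtain ⟨x, hx1, hx2⟩ : ∃ x, i ≤ 13 * p + 6 * q + k * x ∧ 13 * p + 6 * q + k * x < i + k := by
      by_cases h : i ≤ 13 * p + 6 * q
      · exact ⟨0, by omega, by omega⟩
      · have h1 := Nat.div_add_mod (i - (13 * p + 6 * q) + (k - 1)) k
        have h2 := Nat.mod_lt (i - (13 * p + 6 * q) + (k - 1)) (show 0 < k by omega)
        exact ⟨(i - (13 * p + 6 * q) + (k - 1)) / k, by omega, by omega⟩
    have key : ∀ j < m * (2 * p + q), W (13 * p + 6 * q + k * (x + j)) =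
        W (x + j + m * (7 * p + 3 * q)) + 2 := by
      intro j hj
      have h1 : k * (j + 1) ≤ k * (m * (2 * p + q)) := Nat.mul_le_mul_left k hj
      rw [← mul_assoc, mul_add, mul_one] at h1
      have h2 := hL (13 * p + 6 * q + k * (x + j) - i) (by rw [mul_add]; omega)
      rw [Nat.add_sub_cancel' (by rw [mul_add]; omega), mul_assoc, add_assoc (13 * p + 6 * q),
        ← mul_add, hW.last (x + j + _) (by have : 0 < m * (7 * p + 3 * q) := by positivity
                                           omega)] at h2
      exact h2
    -- For `x = 0` the letter is the final `1` of `v`, while its copy ends a block and is at least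
    -- `2`.
    by_cases hx : x = 0
    · have h1 := key 0 (by positivity)
      rw [hx, ← place_three, add_zero, mul_zero, add_zero, hW.one 3 rfl] at h1
      omega
    · refine ih m ?_ hm1 x (by omega) fun j hj => ?_
      · exact (Nat.lt_mul_iff_one_lt_left hm1).2 (by omega)
      · have h1 := key j hj
        rw [hW.last _ (by omega)] at h1
        omega

/-! ### Words given by their runs of zeros -/

/-- The length of `runs (L.take j)`. -/
def runsStart (L : List (ℤ × ℕ)) (j : ℕ) : ℕ := ((L.take j).map fun x => x.1.toNat + 1).sum

theorem length_runs (L : List (ℤ × ℕ)) :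
    (runs L).length = (L.map fun x => x.1.toNat + 1).sum := by
  simp [runs, List.length_flatMap]

theorem runs_cons (x : ℤ × ℕ) (L : List (ℤ × ℕ)) :
    runs (x :: L) = List.replicate x.1.toNat 0 ++ x.2 :: runs L := by
  simp [runs]

theorem runsStart_cons (x : ℤ × ℕ) (L : List (ℤ × ℕ)) (j : ℕ) :
    runsStart (x :: L) (j + 1) = runsStart L j + (x.1.toNat + 1) := by
  rw [runsStart, List.take_succ_cons, List.map_cons, List.sum_cons, runsStart, add_comm]

theorem runs_cons_getD (x : ℤ × ℕ) (L : List (ℤ × ℕ)) (i : ℕ) :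
    (runs (x :: L)).getD (i + (x.1.toNat + 1)) 0 = (runs L).getD i 0 := by
  rw [runs_cons, List.getD_append_right _ _ _ _ (by rw [List.length_replicate]; omega),
    List.length_replicate, show i + (x.1.toNat + 1) - x.1.toNat = i + 1 by omega,
    List.getD_cons_succ]

theorem runs_getD_eq_zero (L : List (ℤ × ℕ)) : ∀ j (h : j < L.length) y, y < (L[j].1).toNat →
    (runs L).getD (runsStart L j + y) 0 = 0 := by
  induction L with
  | nil => intro j h; simp at h
  | cons x L ih =>
    intro j h y hy
    obtain _ | j := j
    · simp only [List.getElem_cons_zero] at hy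
      have : y < (List.replicate x.1.toNat 0).length := by simpa using hy
      rw [runs_cons, runsStart, List.take_zero, List.map_nil, List.sum_nil, zero_add,
        List.getD_append _ _ _ _ this, List.getD_eq_getElem _ _ this, List.getElem_replicate]
    · simp only [List.getElem_cons_succ] at hy
      rw [runsStart_cons, add_right_comm, runs_cons_getD]
      exact ih j _ y hy

theorem runs_getD_eq_letter (L : List (ℤ × ℕ)) : ∀ j (h : j < L.length),
    (runs L).getD (runsStart L j + (L[j].1).toNat) 0 = L[j].2 := by
  induction L with
  | nil => intro j h; simp at h
  | cons x L ih =>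
    intro j h
    obtain _ | j := j
    · rw [runs_cons, runsStart, List.take_zero, List.map_nil, List.sum_nil, zero_add,
        List.getD_append_right _ _ _ _ (by simp)]
      simp
    · simp only [List.getElem_cons_succ]
      rw [runsStart_cons, add_right_comm, runs_cons_getD]
      exact ih j _

theorem runsStart_succ (L : List (ℤ × ℕ)) {j : ℕ} (h : j < L.length) :
    runsStart L (j + 1) = runsStart L j + ((L[j].1).toNat + 1) := by
  unfold runsStart
  rw [List.map_take, List.map_take, List.sum_take_succ _ _ (by simpa using h), List.getElem_map]

/-- The runs of `φ(n)`. -/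
def phiRuns (a b : ℤ) (n : ℕ) : List (ℤ × ℕ) :=
    [(a-b-1, 1), (2*a-2*b-1, 1), (-a+2*b-1, 1), (2*a-2*b-1, 1), (a-b-1, 1), (-2*a+3*b-1, 1),
      (4*a-5*b-1, 1),
     (-a+2*b-1, 1), (2*a-2*b-1, 1), (a-b-1, 1), (-2*a+3*b-1, 1), (-2*a+3*b-1, 1),
      (5*a-6*b-1, 1),
     (-2*a+3*b-1, 1), (4*a-5*b-1, 1), (a-b-1, 1), (-2*a+3*b-1, 1), (3*a-3*b-1, 1),
      (-2*a+3*b-1, 1),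
     (a-b-1, 1), (-3*a+4*b-1, 1), (5*a-6*b-1, 1), (2*a-2*b-1, 1), (a-b-1, 1),
      (-2*a+3*b-1, 1),
     (3*a-3*b-1, 1), (-2*a+3*b-1, 1), (4*a-5*b-1, 1), (a-b-1, 1), (-2*a+3*b-1, 1),
      (2*a-2*b-1, 2),
     (a-b-1, 1), (-2*a+3*b-1, 1), (3*a-3*b-1, 1), (-2*a+3*b-1, 1), (a-b-1, 1),
      (a-b-1, n+2)]

theorem phiNum_eq (a b : ℤ) (n : ℕ) : phiNum a b n = runs (phiRuns a b n) := rfl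

theorem phiRuns_length (a b : ℤ) (n : ℕ) : (phiRuns a b n).length = 37 := rfl

/-- The dictionary between `a, b` and `p, q`; positivity of `p` and `q` ensures that `Int.toNat`
truncates nothing. -/
theorem phiRuns_gaps {p q : ℕ} (hp : 0 < p) (hq : 0 < q) {a b : ℤ} (ha : a = 9 * p + 4 * q)
    (hb : b = 7 * p + 3 * q) (n : ℕ) :
    (phiRuns a b n).map (fun x => x.1.toNat + 1) = gapCycle.map (formVal p q) := by
  simp only [phiRuns, gapCycle, List.map_cons, List.map_nil, formVal, List.cons.injEq]
  refine ⟨?_, ?_, ?_, ?_, ?_, ?_, ?_, ?_, ?_, ?_, ?_, ?_, ?_, ?_, ?_, ?_, ?_, ?_, ?_, ?_, ?_, ?_,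
    ?_, ?_, ?_, ?_, ?_, ?_, ?_, ?_, ?_, ?_, ?_, ?_, ?_, ?_, ?_, trivial⟩ <;> omega

theorem phiRuns_gap {p q : ℕ} (hp : 0 < p) (hq : 0 < q) {a b : ℤ} (ha : a = 9 * p + 4 * q)
    (hb : b = 7 * p + 3 * q) (n : ℕ) {j : ℕ} (hj : j < (phiRuns a b n).length) :
    ((phiRuns a b n)[j].1).toNat + 1 = formVal p q (gap (3 + j + 1)) := by
  have h := congrArg (fun l => l.getD j 0) (phiRuns_gaps hp hq ha hb n)
  have hj' : j < gapCycle.length := hj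
  have hj37 : j < 37 := hj
  simp only [List.getD_eq_getElem?_getD, List.getElem?_map, List.getElem?_eq_getElem hj,
    List.getElem?_eq_getElem hj', Option.map_some, Option.getD_some] at h
  rw [h, gap, if_neg (by omega), show (3 + j + 1 + 33) % 37 = j by omega,
    List.getD_eq_getElem _ _ hj']

theorem phiRuns_start {p q : ℕ} (hp : 0 < p) (hq : 0 < q) {a b : ℤ} (ha : a = 9 * p + 4 * q)
    (hb : b = 7 * p + 3 * q) (n : ℕ) {j : ℕ} (hj : j ≤ 37) :
    runsStart (phiRuns a b n) j = formVal p q (span 3 j) := by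
  induction j with
  | zero => simp [runsStart, span, formVal]
  | succ j ih =>
    have hj' : j < (phiRuns a b n).length := by rw [phiRuns_length]; omega
    rw [runsStart_succ _ hj', ih (by omega), phiRuns_gap hp hq ha hb n hj', span, formVal_add]

theorem length_phiNum {p q : ℕ} (hp : 0 < p) (hq : 0 < q) {a b : ℤ} (ha : a = 9 * p + 4 * q)
    (hb : b = 7 * p + 3 * q) (n : ℕ) : (phiNum a b n).length = 111 * p + 51 * q := by
  rw [phiNum_eq, length_runs]
  have := phiRuns_start hp hq ha hb n (j := 37) le_rfl
  rw [runsStart, List.take_of_length_le (by rw [phiRuns_length]), span_period (by norm_num)]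
    at this
  rw [this, formVal]

/-- The runs of `τ(v)`. -/
def transientRuns (a b : ℤ) : List (ℤ × ℕ) := [(a-1, 1), (a-b-1, 1), (a-b-1, 1)]

theorem transient_eq {a : ℤ} (b : ℤ) (ha : 2 ≤ a) :
    0 :: runs [(a-2, 1), (a-b-1, 1), (a-b-1, 1)] = runs (transientRuns a b) := by
  rw [transientRuns, runs_cons (a - 2, 1), runs_cons (a - 1, 1)]
  simp only [show (a - 1).toNat = (a - 2).toNat + 1 by omega, List.replicate_succ,
    List.cons_append]

theorem transientRuns_gap {p q : ℕ} (hp : 0 < p) (hq : 0 < q) {a b : ℤ}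
    (ha : a = 9 * p + 4 * q) (hb : b = 7 * p + 3 * q) {j : ℕ}
    (hj : j < (transientRuns a b).length) :
    ((transientRuns a b)[j].1).toNat + 1 = formVal p q (gap (j + 1)) := by
  have : j < 3 := hj
  interval_cases j
  all_goals
    simp [transientRuns, gap, gapCycle, formVal]
    omega

theorem transientRuns_start {p q : ℕ} (hp : 0 < p) (hq : 0 < q) {a b : ℤ}
    (ha : a = 9 * p + 4 * q) (hb : b = 7 * p + 3 * q) {j : ℕ} (hj : j ≤ 3) :
    runsStart (transientRuns a b) j = place p q j := by
  induction j with
  | zero => simp [runsStart, place_zero]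
  | succ j ih =>
    have hj' : j < (transientRuns a b).length := by simp only [transientRuns]; simp; omega
    rw [runsStart_succ _ hj', ih (by omega), transientRuns_gap hp hq ha hb hj', place_succ]

theorem length_transient {p q : ℕ} (hp : 0 < p) (hq : 0 < q) {a b : ℤ}
    (ha : a = 9 * p + 4 * q) (hb : b = 7 * p + 3 * q) :
    (runs (transientRuns a b)).length = 13 * p + 6 * q := by
  rw [length_runs]
  have := transientRuns_start hp hq ha hb (j := 3) le_rfl
  rwa [runsStart, List.take_of_length_le (by simp [transientRuns]), place_three] at this

/-! ### The fixed point of the morphism -/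

theorem morphLimit_eq_getElem {α : Type*} (φ : α → List α) (hφ : ∀ x, φ x ≠ []) (c : α)
    (t : List α) (hc : φ c = c :: t) (ht : t ≠ []) {n i : ℕ}
    (h : i < ((morphExtend φ)^[n] [c]).length) :
    morphLimit φ c i = ((morphExtend φ)^[n] [c])[i] := by
  have h1 := morphLimit_prefix φ hφ c t hc ht n
  have h2 := congrArg (fun l => l[i]?) h1
  simp only [factor, List.getElem?_map, List.getElem?_range h, Option.map_some,
    List.getElem?_eq_getElem h, Option.some.injEq, Nat.zero_add] at h2
  exact h2

theorem getD_flatMap {α β : Type*} (f : α → List β) (k : ℕ) (hf : ∀ x, (f x).length = k) (d : β)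
    (l : List α) : ∀ t (ht : t < l.length) r, r < k →
      (l.flatMap f).getD (k * t + r) d = (f l[t]).getD r d := by
  induction l with
  | nil => intro t ht; simp at ht
  | cons x l ih =>
    intro t ht r hr
    rw [List.flatMap_cons]
    obtain _ | t := t
    · rw [List.getD_append _ _ _ _ (by rw [hf]; omega)]
      simp
    · rw [List.getD_append_right _ _ _ _ (by rw [hf, mul_add]; omega), hf,
        show k * (t + 1) + r - k = k * t + r by rw [mul_add]; omega,
        ih t (by simpa using ht) r hr]
      simp

/-- The words `τ(φⁿ(0'))` without their first letters. -/
def tailWord (a b : ℤ) : ℕ → List ℕ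
  | 0 => []
  | n + 1 => runs [(a-2, 1), (a-b-1, 1), (a-b-1, 1)] ++ phiNum a b 0 ++
      (tailWord a b n).flatMap (phiNum a b)

/-- The letter `0'` occurs only in front, so the iterates reduce to words of natural numbers. -/
theorem iterate_phi (a b : ℤ) (n : ℕ) : (morphExtend (phi a b))^[n] [Letter.zeroPrime] =
    Letter.zeroPrime :: (tailWord a b n).map Letter.num := by
  induction n with
  | zero => rfl
  | succ n ih =>
    rw [Function.iterate_succ_apply', ih, morphExtend, List.flatMap_cons, phi, transient, tailWord,
      List.flatMap_map, List.map_append, List.map_append, List.map_flatMap, List.cons_append,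
      List.cons_append]
    rfl

/-- The word `τ(φ^∞(0'))`. -/
def limitWord (a b : ℤ) (i : ℕ) : ℕ := tau (morphLimit (phi a b) .zeroPrime i)

theorem limitWord_eq_getD (a b : ℤ) {n i : ℕ} (h : i < (0 :: tailWord a b n).length) :
    limitWord a b i = (0 :: tailWord a b n).getD i 0 := by
  have h1 : ∀ x, phi a b x ≠ [] := by
    intro x
    cases x <;> simp [phi, transient, phiNum, runs]
  have h2 : i < ((morphExtend (phi a b))^[n] [Letter.zeroPrime]).length := by
    rw [iterate_phi]; simpa using h
  rw [limitWord, morphLimit_eq_getElem (phi a b) h1 .zeroPrime _ rfl (by simp [runs]) h2]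
  simp only [iterate_phi]
  obtain _ | i := i
  · rfl
  · have : i < (tailWord a b n).length := by simpa using h
    simp [tau, this]

theorem lt_length_tailWord (a b : ℤ) (n : ℕ) : n < (0 :: tailWord a b n).length := by
  have h1 : ∀ x, phi a b x ≠ [] := by
    intro x
    cases x <;> simp [phi, transient, phiNum, runs]
  have := lt_length_iterate (phi a b) h1 .zeroPrime _ rfl (by simp [runs]) n
  rw [iterate_phi] at this
  simpa using this

theorem limitWord_of_lt {a b : ℤ} (ha : 2 ≤ a) {x : ℕ}
    (hx : x < (runs (transientRuns a b)).length) :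
    limitWord a b x = (runs (transientRuns a b)).getD x 0 := by
  have h : 0 :: tailWord a b 1 = runs (transientRuns a b) ++ phiNum a b 0 := by
    simp [tailWord, ← transient_eq b ha]
  rw [limitWord_eq_getD a b (n := 1) (by rw [h, List.length_append]; omega), h,
    List.getD_append _ _ _ _ hx]

/-- This is the equation `W = v φ(W)`, read off from a prefix with more than `t` letters. -/
theorem limitWord_block {a b : ℤ} (ha : 2 ≤ a) {k : ℕ} (hk : ∀ n, (phiNum a b n).length = k)
    (t : ℕ) {r : ℕ} (hr : r < k) :
    limitWord a b ((runs (transientRuns a b)).length + k * t + r) =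
      (phiNum a b (limitWord a b t)).getD r 0 := by
  have h : 0 :: tailWord a b (t + 1) =
      runs (transientRuns a b) ++ (0 :: tailWord a b t).flatMap (phiNum a b) := by
    simp [tailWord, ← transient_eq b ha]
  have ht := lt_length_tailWord a b t
  have hlen : ((0 :: tailWord a b t).flatMap (phiNum a b)).length =
      k * (0 :: tailWord a b t).length := by
    rw [List.length_flatMap, funext hk]
    simp [mul_comm, add_comm, mul_add]
  have hlt : k * t + r < k * (0 :: tailWord a b t).length := by
    have := Nat.mul_le_mul_left k ht
    rw [Nat.succ_eq_add_one, mul_add] at this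
    omega
  rw [limitWord_eq_getD a b (n := t + 1) (by rw [h, List.length_append, hlen]; omega), h,
    List.getD_append_right _ _ _ _ (by omega), add_assoc, Nat.add_sub_cancel_left,
    getD_flatMap _ k hk 0 _ t ht r hr, limitWord_eq_getD a b ht, List.getD_eq_getElem _ _ ht]

theorem exists_phiNum_eq (a b : ℤ) : ∃ l, ∀ n, phiNum a b n = l ++ [n + 2] := by
  refine ⟨runs ((phiRuns a b 0).take 36) ++ List.replicate (a - b - 1).toNat 0, fun n => ?_⟩
  have h : phiRuns a b n = (phiRuns a b 0).take 36 ++ [(a - b - 1, n + 2)] := rfl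
  rw [phiNum_eq, h, runs, List.flatMap_append, ← runs, List.append_assoc]
  simp

theorem phiNum_getD_of_lt (a b : ℤ) (m n : ℕ) {r : ℕ} (hr : r + 1 < (phiNum a b n).length) :
    (phiNum a b n).getD r 0 = (phiNum a b m).getD r 0 := by
  obtain ⟨l, hl⟩ := exists_phiNum_eq a b
  rw [hl, List.length_append, List.length_singleton] at hr
  rw [hl, hl, List.getD_append _ _ _ _ (by omega), List.getD_append _ _ _ _ (by omega)]

theorem phiNum_getD_last (a b : ℤ) (n : ℕ) {r : ℕ} (hr : r + 1 = (phiNum a b n).length) :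
    (phiNum a b n).getD r 0 = n + 2 := by
  obtain ⟨l, hl⟩ := exists_phiNum_eq a b
  rw [hl, List.length_append, List.length_singleton] at hr
  rw [hl, List.getD_append_right _ _ _ _ (by omega), show r - l.length = 0 by omega]
  rfl

theorem phiRuns_letter_eq_one (a b : ℤ) (n : ℕ) {j : ℕ} (hj : j < (phiRuns a b n).length)
    (h30 : j ≠ 30) (h36 : j ≠ 36) : ((phiRuns a b n)[j]).2 = 1 := by
  have h : ∀ i : Fin 37, i.1 ≠ 30 → i.1 ≠ 36 →
      (((phiRuns a b n).map Prod.snd)[i.1]'(i.2.trans_eq rfl)) = 1 := by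
    intro i
    fin_cases i <;> simp [phiRuns]
  exact (List.getElem_map Prod.snd).symm.trans (h ⟨j, hj⟩ h30 h36)

section

variable {p q : ℕ} {a b : ℤ}

theorem place_block (hp : 0 < p) (hq : 0 < q) (ha : a = 9 * p + 4 * q) (hb : b = 7 * p + 3 * q)
    (t n : ℕ) {j : ℕ} (hj : j ≤ 37) : place p q (3 + 37 * t + j) =
      13 * p + 6 * q + (111 * p + 51 * q) * t + runsStart (phiRuns a b n) j := by
  have h : ∀ t, span (3 + 37 * t) j = span 3 j := by
    intro t
    induction t with
    | zero => rfl
    | succ t ih =>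
      rw [show 3 + 37 * (t + 1) = 3 + 37 * t + 37 by ring, span_add_period (by omega), ih]
  rw [phiRuns_start hp hq ha hb n hj, place_add, h, place_add_mul_period p q (by norm_num),
    place_three]

theorem limitWord_block_getD (hp : 0 < p) (hq : 0 < q) (ha : a = 9 * p + 4 * q)
    (hb : b = 7 * p + 3 * q) (t : ℕ) {r : ℕ} (hr : r < 111 * p + 51 * q) :
    limitWord a b (13 * p + 6 * q + (111 * p + 51 * q) * t + r) =
      (phiNum a b (limitWord a b t)).getD r 0 := by
  rw [← limitWord_block (by omega) (length_phiNum hp hq ha hb) t hr,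
    length_transient hp hq ha hb]

theorem runsStart_lt (hp : 0 < p) (hq : 0 < q) (ha : a = 9 * p + 4 * q)
    (hb : b = 7 * p + 3 * q) (n : ℕ) {j : ℕ} (hj : j < (phiRuns a b n).length) :
    runsStart (phiRuns a b n) j + ((phiRuns a b n)[j].1).toNat < 111 * p + 51 * q := by
  have h1 := runsStart_succ _ hj
  rw [phiRuns_length] at hj
  have h2 := place_block hp hq ha hb 0 n (j := j + 1) (by omega)
  have h3 : place p q (3 + 37 * 0 + (j + 1)) ≤ place p q (3 + 37) :=
    (place_strictMono hp).monotone (by omega)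
  rw [place_add_period p q (by norm_num), place_three] at h3
  omega

theorem limitWord_letter (hp : 0 < p) (hq : 0 < q) (ha : a = 9 * p + 4 * q)
    (hb : b = 7 * p + 3 * q) (t : ℕ) {j : ℕ} (hj : j < (phiRuns a b (limitWord a b t)).length) :
    limitWord a b (place p q (3 + 37 * t + j + 1) - 1) =
      ((phiRuns a b (limitWord a b t))[j]).2 := by
  have hj' := hj
  rw [phiRuns_length] at hj'
  have h1 := place_block hp hq ha hb t (limitWord a b t) (j := j + 1) (by omega)
  rw [runsStart_succ _ hj] at h1
  rw [← runs_getD_eq_letter _ j hj, ← phiNum_eq, ← limitWord_block_getD hp hq ha hb t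
    (runsStart_lt hp hq ha hb _ hj)]
  congr 1
  rw [add_assoc (3 + 37 * t), h1]
  omega

theorem limitWord_transient (hp : 0 < p) (hq : 0 < q) (ha : a = 9 * p + 4 * q)
    (hb : b = 7 * p + 3 * q) {j : ℕ} (hj : j < 3) :
    limitWord a b (place p q (j + 1) - 1) = 1 ∧
      ∀ x, place p q j < x → x < place p q (j + 1) → limitWord a b (x - 1) = 0 := by
  have hj' : j < (transientRuns a b).length := hj
  have h1 := transientRuns_start hp hq ha hb (j := j) (by omega)
  have h2 := transientRuns_start hp hq ha hb (j := j + 1) (by omega)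
  have h3 := runsStart_succ _ hj'
  have h4 : place p q (j + 1) ≤ place p q 3 := (place_strictMono hp).monotone (by omega)
  rw [place_three] at h4
  have hlen := length_transient hp hq ha hb
  constructor
  · rw [limitWord_of_lt (by omega) (by omega), show place p q (j + 1) - 1 =
      runsStart (transientRuns a b) j + ((transientRuns a b)[j].1).toNat by omega,
      runs_getD_eq_letter _ j hj']
    interval_cases j <;> rfl
  · intro x hx hx'
    rw [limitWord_of_lt (by omega) (by omega), show x - 1 =
      runsStart (transientRuns a b) j + (x - 1 - runsStart (transientRuns a b) j) by omega,
      runs_getD_eq_zero _ j hj' _ (by omega)]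

theorem limitWord_isMarked (hp : 0 < p) (hq : 0 < q) (ha : a = 9 * p + 4 * q)
    (hb : b = 7 * p + 3 * q) : IsMarked p q fun x => limitWord a b (x - 1) := by
  have hdecomp : ∀ n, 3 ≤ n → ∃ t j, n = 3 + 37 * t + j ∧ j < 37 := fun n hn =>
    ⟨(n - 3) / 37, (n - 3) % 37, by omega, Nat.mod_lt _ (by norm_num)⟩
  have hmark : ∀ t j, j < 37 → mark (3 + 37 * t + j + 1) =
      if j = 30 then 2 else if j = 36 then 3 else 1 := by
    intro t j hj
    rw [mark, if_neg (by omega), if_neg (by omega),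
      show (3 + 37 * t + j + 1 + 33) % 37 = j by omega]
  have hsmall : ∀ j < 3, mark (j + 1) = 1 := by decide
  constructor
  · intro n hn
    obtain _ | n := n
    · simp [mark] at hn
    rcases lt_or_ge n 3 with h | h
    · exact (limitWord_transient hp hq ha hb h).1
    · obtain ⟨t, j, rfl, hj⟩ := hdecomp n h
      rw [hmark t j hj] at hn
      have h30 : j ≠ 30 := by rintro rfl; simp at hn
      have h36 : j ≠ 36 := by rintro rfl; simp at hn
      exact (limitWord_letter hp hq ha hb t hj).trans (phiRuns_letter_eq_one _ _ _ hj h30 h36)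
  · intro n hn
    obtain _ | n := n
    · simp [mark] at hn
    rcases lt_or_ge n 3 with h | h
    · rw [hsmall n h] at hn; omega
    · obtain ⟨t, j, rfl, hj⟩ := hdecomp n h
      rw [hmark t j hj] at hn
      obtain rfl : j = 30 := by
        by_contra h30
        rw [if_neg h30] at hn
        split_ifs at hn <;> omega
      exact limitWord_letter hp hq ha hb t (j := 30) (by rw [phiRuns_length]; norm_num)
  · intro n hn
    obtain _ | n := n
    · simp [mark] at hn
    rcases lt_or_ge n 3 with h | h
    · rw [hsmall n h] at hn; omega
    · obtain ⟨t, j, rfl, hj⟩ := hdecomp n h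
      rw [hmark t j hj] at hn
      obtain rfl : j = 36 := by
        by_contra h36
        rw [if_neg h36] at hn
        split_ifs at hn <;> omega
      exact (Nat.le_add_left 2 _).trans_eq
        (limitWord_letter hp hq ha hb t (j := 36) (by rw [phiRuns_length]; norm_num)).symm
  · intro n x hx hx'
    rcases lt_or_ge n 3 with h | h
    · exact (limitWord_transient hp hq ha hb h).2 x hx hx'
    · obtain ⟨t, j, rfl, hj⟩ := hdecomp n h
      have hj' : j < (phiRuns a b (limitWord a b t)).length := hj
      have h1 := place_block hp hq ha hb t (limitWord a b t) (j := j) (by omega)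
      have h2 := place_block hp hq ha hb t (limitWord a b t) (j := j + 1) (by omega)
      have h3 := runsStart_lt hp hq ha hb _ hj'
      rw [runsStart_succ _ hj'] at h2
      rw [add_assoc] at hx'
      change limitWord a b (x - 1) = 0
      rw [show x - 1 = 13 * p + 6 * q + (111 * p + 51 * q) * t +
        (runsStart (phiRuns a b (limitWord a b t)) j +
          (x - 1 - place p q (3 + 37 * t + j))) by omega,
        limitWord_block_getD hp hq ha hb t (by omega), phiNum_eq,
        runs_getD_eq_zero _ j hj' _ (by omega)]

theorem limitWord_isSelfSimilar (hp : 0 < p) (hq : 0 < q) (ha : a = 9 * p + 4 * q)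
    (hb : b = 7 * p + 3 * q) : IsSelfSimilar p q fun x => limitWord a b (x - 1) where
  toIsMarked := limitWord_isMarked hp hq ha hb
  periodic x y r hr hr' := by
    have hlen := length_phiNum hp hq ha hb (limitWord a b x)
    simp only [Nat.add_sub_assoc (show 1 ≤ r from hr)]
    rw [limitWord_block_getD hp hq ha hb _ (by omega),
      limitWord_block_getD hp hq ha hb _ (by omega)]
    exact phiNum_getD_of_lt _ _ _ _ (by omega)
  last x hx := by
    have hlen := length_phiNum hp hq ha hb (limitWord a b (x - 1))
    obtain ⟨x, rfl⟩ : ∃ y, x = y + 1 := ⟨x - 1, by omega⟩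
    rw [Nat.add_sub_cancel] at hlen
    simp only [Nat.add_sub_cancel]
    rw [mul_add, mul_one, ← add_assoc, Nat.add_sub_assoc (by omega),
      limitWord_block_getD hp hq ha hb _ (by omega)]
    exact phiNum_getD_last _ _ _ (by omega)

end

/-! ### Power-freeness and leastness -/

theorem factor_getElem? {α : Type*} (w : ℕ → α) (i : ℕ) {l j : ℕ} (h : j < l) :
    (factor w i l)[j]? = some (w (i + j)) := by
  simp [factor, h]

theorem factor_length {α : Type*} (w : ℕ → α) (i l : ℕ) : (factor w i l).length = l := by
  simp [factor]

/-- As `⌊a / b⌋ = 1`, a power is `x x'` with `|x| = m b` and `x'` the prefix of `x` of length `m (a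
- b)`. -/
theorem isFracPow_factor_iff {α : Type*} {a b : ℕ} (hb : 0 < b) (hab : b < a) (hab2 : a < 2 * b)
    (w : ℕ → α) (i l : ℕ) : IsFracPow a b (factor w i l) ↔
      ∃ m, 1 ≤ m ∧ l = m * a ∧ ∀ j < m * (a - b), w (i + j) = w (i + j + m * b) := by
  have hdiv : a / b = 1 := Nat.div_eq_of_lt_le (by omega) (by omega)
  have hmod : a % b = a - b := by
    rw [Nat.mod_eq_sub_mul_div, hdiv, mul_one]
  have htake : ∀ m, b * m * (a - b) / b = m * (a - b) := fun m => by
    rw [mul_assoc, Nat.mul_div_cancel_left _ hb]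
  constructor
  · rintro ⟨v, hv, ⟨m, hm⟩, h⟩
    rw [fracPow, hdiv, hmod, hm, htake] at h
    simp only [List.replicate_one, List.flatten_singleton] at h
    have hm1 : 1 ≤ m := by
      rcases Nat.eq_zero_or_pos m with rfl | h
      · simp [hv] at hm
      · exact h
    have hle : m * (a - b) ≤ v.length := by
      rw [hm, mul_comm]; exact Nat.mul_le_mul_right _ (by omega)
    have hlen := congrArg List.length h
    rw [factor_length, List.length_append, List.length_take, min_eq_left hle, hm] at hlen
    have hl : l = m * a := by
      rw [hlen, mul_comm b m, ← mul_add]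
      congr 1; omega
    refine ⟨m, hm1, hl, fun j hj => ?_⟩
    have hj1 : j < v.length := by omega
    have hsum : m * a = m * b + m * (a - b) := by rw [← mul_add]; congr 1; omega
    have h1 := congrArg (fun u => u[j]?) h
    have h2 := congrArg (fun u => u[j + m * b]?) h
    rw [factor_getElem? _ _ (by omega), List.getElem?_append_left hj1] at h1
    rw [factor_getElem? _ _ (by omega), List.getElem?_append_right (by rw [hm, mul_comm]; omega),
      hm, mul_comm b m, Nat.add_sub_cancel, List.getElem?_take_of_lt hj, ← h1,
      Option.some.injEq, ← add_assoc] at h2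
    exact h2.symm
  · rintro ⟨m, hm, rfl, h⟩
    have hsum : m * a = m * b + m * (a - b) := by rw [← mul_add]; congr 1; omega
    have hle : m * (a - b) ≤ m * b := Nat.mul_le_mul_left _ (by omega)
    refine ⟨factor w i (m * b), ?_, ⟨m, by rw [factor_length, mul_comm]⟩, ?_⟩
    · rw [← List.length_pos_iff, factor_length]; positivity
    · rw [fracPow, hdiv, hmod, factor_length, mul_comm m b, htake, mul_comm b m]
      simp only [List.replicate_one, List.flatten_singleton]
      apply List.ext_getElem?
      intro j
      rcases lt_or_ge j (m * b) with h1 | h1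
      · rw [factor_getElem? _ _ (by omega), List.getElem?_append_left (by rwa [factor_length]),
          factor_getElem? _ _ h1]
      · rw [List.getElem?_append_right (by rwa [factor_length]), factor_length]
        rcases lt_or_ge j (m * a) with h2 | h2
        · rw [factor_getElem? _ _ h2, List.getElem?_take_of_lt (by omega),
            factor_getElem? _ _ (by omega), h (j - m * b) (by omega)]
          congr 2; omega
        · rw [List.getElem?_eq_none (by rwa [factor_length]),
            List.getElem?_eq_none (by rw [List.length_take, factor_length]; omega)]

theorem powerFree_iff {α : Type*} {a b : ℕ} (hb : 0 < b) (hab : b < a) (hab2 : a < 2 * b)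
    (w : ℕ → α) : PowerFree a b w ↔
      ∀ m, 1 ≤ m → ∀ i, ¬ ∀ j < m * (a - b), w (i + j) = w (i + j + m * b) := by
  constructor
  · intro h m hm i hj
    exact h i (m * a) ((isFracPow_factor_iff hb hab hab2 w i _).2 ⟨m, hm, rfl, hj⟩)
  · intro h i l hl
    obtain ⟨m, hm, -, hj⟩ := (isFracPow_factor_iff hb hab hab2 w i l).1 hl
    exact h m hm i hj

/-- A power-free word is lexicographically least if no letter can be made smaller without
creating a power that ends there. -/
theorem isLexLeastPowerFree_of_blocks {a b : ℕ} (hb : 0 < b) (hab : b < a) (hab2 : a < 2 * b)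
    {w : ℕ → ℕ} (hw : PowerFree a b w)
    (h : ∀ x, ∀ c < w x, ∃ m, 1 ≤ m ∧ m * a ≤ x + 1 ∧ w (x - m * b) = c ∧
      ∀ t, 0 < t → t < m * (a - b) → w (x - t) = w (x - m * b - t)) :
    IsLexLeastPowerFree a b w := by
  refine ⟨hw, fun u hu => ?_⟩
  by_contra hlt
  rw [not_le] at hlt
  obtain ⟨x, hx, hxlt⟩ := hlt
  have hx' : ∀ j < x, ofLex u j = w j := hx
  obtain ⟨m, hm, hmx, hc, ht⟩ := h x (ofLex u x) hxlt
  have hsum : m * a = m * b + m * (a - b) := by rw [← mul_add]; congr 1; omega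
  have hpos : 0 < m * b := by positivity
  have hpos' : 0 < m * (a - b) := Nat.mul_pos hm (by omega)
  refine (powerFree_iff hb hab hab2 _).1 hu m hm (x + 1 - m * a) fun j hj => ?_
  rw [hx' _ (by omega)]
  rcases Nat.lt_or_ge (j + 1) (m * (a - b)) with h1 | h1
  · have h2 := ht (m * (a - b) - 1 - j) (by omega) (by omega)
    rw [hx' _ (by omega), show x + 1 - m * a + j + m * b = x - (m * (a - b) - 1 - j) by omega, h2]
    congr 1; omega
  · rw [show x + 1 - m * a + j + m * b = x by omega, ← hc]
    congr 1; omega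

theorem limitWord_isLexLeastPowerFree {p q a b : ℕ} (hp : 0 < p) (hq : 0 < q) (hpq : p ≠ q)
    (ha : a = 9 * p + 4 * q) (hb : b = 7 * p + 3 * q)
    (hcop : Nat.Coprime (111 * p + 51 * q) b) :
    IsLexLeastPowerFree a b (limitWord a b) := by
  have hW := limitWord_isSelfSimilar (a := a) (b := b) hp hq (by subst ha; push_cast; ring)
    (by subst hb; push_cast; ring)
  have hab : a - b = 2 * p + q := by omega
  have hb0 : 0 < b := by omega
  refine isLexLeastPowerFree_of_blocks hb0 (by omega) (by omega)
    ((powerFree_iff hb0 (by omega) (by omega) _).2 fun m hm i h => ?_) fun x c hc => ?_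
  · refine hW.not_agree hp hq hpq (hb ▸ hcop) hm (i + 1) (by omega) fun j hj => ?_
    have := h j (by rwa [hab])
    rw [← hb]
    rw [show i + 1 + j - 1 = i + j by omega, show i + 1 + j + m * b - 1 = i + j + m * b by omega,
      this]
  · obtain ⟨m, hm, hmx, hc', ht⟩ := hW.exists_blocks hp hq (x := x + 1) (by omega) c hc
    have e1 : m * (9 * p + 4 * q) = m * (7 * p + 3 * q) + m * (2 * p + q) := by ring
    have e2 : 0 < m * (2 * p + q) := by positivity
    rw [hab, ha, hb]
    subst ha hb
    refine ⟨m, hm, hmx, ?_, fun t h0 h1 => ?_⟩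
    · rw [← hc']
      simp only
      congr 1; omega
    · have := ht t h0 h1
      simp only at this
      rw [show x + 1 - t - 1 = x - t by omega,
        show x + 1 - m * (7 * p + 3 * q) - t - 1 = x - m * (7 * p + 3 * q) - t by omega] at this
      exact this

/-! ### Regular sequences -/

/-- Modulo `q` the span of the kernel becomes a finitely generated torsion `ℤ`-module, which is
finite. -/
theorem IsRegular.finite_mod {l : ℕ} {s : ℕ → ℤ} (h : IsRegular l s) (q : ℕ) [NeZero q] :
    {t : ℕ → ZMod q | ∃ e j : ℕ, j < l ^ e ∧ t = fun i => (s (l ^ e * i + j) : ZMod q)}.Finite := by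
  let f : (ℕ → ℤ) →ₗ[ℤ] (ℕ → ZMod q) :=
    { toFun := fun u i => (u i : ZMod q)
      map_add' := fun u v => by ext i; simp
      map_smul' := fun c u => by ext i; simp }
  have h1 : ((Submodule.span ℤ (kernel l s)).map f).FG := h.map f
  have h2 : Module.Finite ℤ ((Submodule.span ℤ (kernel l s)).map f) := Module.Finite.iff_fg.2 h1
  have h3 : Module.IsTorsion ℤ ((Submodule.span ℤ (kernel l s)).map f) := by
    intro x
    refine ⟨⟨(q : ℤ), mem_nonZeroDivisors_of_ne_zero (by exact_mod_cast NeZero.ne q)⟩, ?_⟩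
    ext i
    simp [Submonoid.smul_def]
  have h4 : Finite ((Submodule.span ℤ (kernel l s)).map f) := Module.finite_of_fg_torsion _ h3
  refine Set.Finite.subset (Set.toFinite ((Submodule.span ℤ (kernel l s)).map f : Set _)) ?_
  rintro t ⟨e, j, hj, rfl⟩
  exact ⟨_, Submodule.subset_span ⟨e, j, hj, rfl⟩, rfl⟩

theorem exists_large_modEq {c n : ℕ} (hn : 0 < n) (h : Nat.Coprime c n) (r B : ℕ) :
    ∃ i, B ≤ i ∧ c * i ≡ r [MOD n] := by
  obtain ⟨m, -, hm⟩ := Nat.exists_mul_mod_eq_of_coprime r h hn.ne'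
  refine ⟨m + n * B, ?_, ?_⟩
  · exact (Nat.le_mul_of_pos_left B hn).trans (Nat.le_add_left _ _)
  · rw [Nat.ModEq, mul_add, ← mul_assoc, mul_comm c n, mul_assoc, Nat.add_mul_mod_self_left, hm]

/-! ### Shift-fixed words and powers of `D + 1` in `D x + s` -/

/-- `W` is a fixed point of a uniform morphism of length `D + 1` that adds `2` to the last letter
and does not depend on its argument otherwise, with a transient of length `s`. -/
structure IsShiftFixed (D s : ℕ) (W : ℕ → ℕ) : Prop where
  periodic : ∀ x y r, 0 < r → r < D + 1 → W (s + (D + 1) * x + r) = W (s + (D + 1) * y + r)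
  last : ∀ x, 1 ≤ x → W (s + (D + 1) * x) = W x + 2

/-- Since `D ≡ -1` modulo `D + 1`, the residue of `D x + s` is that of `s - x`: it determines the
place of `x` in its block, and it vanishes only at the last letters. -/
theorem IsShiftFixed.eq_of_modEq {D s : ℕ} {W : ℕ → ℕ} (hW : IsShiftFixed D s W) {x x' : ℕ}
    (hx : s < x) (hx' : s < x') (hmod : D * x + s ≡ D * x' + s [MOD D + 1])
    (hdvd : ¬ D + 1 ∣ D * x + s) : W x = W x' := by
  have hcop : Nat.Coprime (D + 1) D := by simp
  have h1 : x ≡ x' [MOD D + 1] :=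
    Nat.ModEq.cancel_left_of_coprime hcop (Nat.ModEq.add_right_cancel' s hmod)
  obtain ⟨a, rfl⟩ : ∃ a, x = s + a := ⟨x - s, by omega⟩
  obtain ⟨a', rfl⟩ : ∃ a, x' = s + a := ⟨x' - s, by omega⟩
  have h2 : a % (D + 1) = a' % (D + 1) := Nat.ModEq.add_left_cancel' s h1
  have h3 := Nat.div_add_mod a (D + 1)
  have h4 := Nat.div_add_mod a' (D + 1)
  have h5 := Nat.mod_lt a (Nat.succ_pos D)
  have h6 : a % (D + 1) ≠ 0 := by
    intro h
    obtain ⟨b, rfl⟩ := Nat.dvd_of_mod_eq_zero h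
    exact hdvd ⟨s + D * b, by ring⟩
  rw [← h3, ← h4, ← h2, ← add_assoc, ← add_assoc]
  exact hW.periodic _ _ _ (by omega) h5

/-- The map `x ↦ s + (D + 1) x` multiplies `D x + s` by `D + 1` and raises the letter by `2`; undo
it `v` times. The bound on `y` keeps `x₀` beyond the transient. -/
theorem IsShiftFixed.exists_eq {D s : ℕ} {W : ℕ → ℕ} (hW : IsShiftFixed D s W) {y : ℕ}
    (hy : D * s + s < y) (v : ℕ) : ∀ x, D * x + s = (D + 1) ^ v * y →
      ∃ x₀, s < x₀ ∧ D * x₀ + s = y ∧ W x = W x₀ + 2 * v := by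
  have hlarge : ∀ v x, D * x + s = (D + 1) ^ v * y → s < x := by
    intro v x hx
    have h1 : y ≤ (D + 1) ^ v * y := Nat.le_mul_of_pos_left _ (by positivity)
    have h2 : D * s < D * x := by omega
    exact lt_of_mul_lt_mul_left h2 (Nat.zero_le D)
  induction v with
  | zero =>
    intro x hx
    exact ⟨x, hlarge 0 x hx, by simpa using hx, by simp⟩
  | succ v ih =>
    intro x hx
    have h0 := hlarge _ x hx
    rw [pow_succ', mul_assoc] at hx
    obtain ⟨x', rfl⟩ : ∃ x', x = s + (D + 1) * x' := by
      set z := (D + 1) ^ v * y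
      refine ⟨x - z, ?_⟩
      have h1 : (D + 1) * z ≤ (D + 1) * x := by
        rw [← hx, add_mul, one_mul]; omega
      have h2 : z ≤ x := Nat.le_of_mul_le_mul_left h1 (Nat.succ_pos D)
      obtain ⟨c, rfl⟩ : ∃ c, x = z + c := ⟨x - z, by omega⟩
      rw [Nat.add_sub_cancel_left]
      nlinarith
    have hx' : D * x' + s = (D + 1) ^ v * y := by
      apply Nat.eq_of_mul_eq_mul_left (Nat.succ_pos D)
      rw [Nat.succ_eq_add_one, ← hx]
      ring
    obtain ⟨x₀, h1, h2, h3⟩ := ih x' hx'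
    refine ⟨x₀, h1, h2, ?_⟩
    rw [hW.last _ (by have := hlarge v x' hx'; omega), h3]
    ring

theorem IsShiftFixed.add_eq_add {D s : ℕ} {W : ℕ → ℕ} (hW : IsShiftFixed D s W)
    {x x' v v' y y' : ℕ} (hx : D * x + s = (D + 1) ^ v * y) (hx' : D * x' + s = (D + 1) ^ v' * y')
    (hy : D * s + s < y) (hy' : D * s + s < y') (hmod : y ≡ y' [MOD D + 1])
    (hdvd : ¬ D + 1 ∣ y) : W x + 2 * v' = W x' + 2 * v := by
  obtain ⟨z, h1, rfl, h3⟩ := hW.exists_eq hy v x hx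
  obtain ⟨z', h1', rfl, h3'⟩ := hW.exists_eq hy' v' x' hx'
  have := hW.eq_of_modEq h1 h1' hmod hdvd
  omega

theorem exists_mul_coprime (k : ℕ) {l : ℕ} (hl : 0 < l) : ∃ l₁ l₂, l = l₁ * l₂ ∧
    Nat.Coprime l₁ k ∧ ∀ r, r.Prime → r ∣ l₂ → r ∣ k := by
  induction l using Nat.strong_induction_on with
  | _ l ih =>
    by_cases h : Nat.Coprime l k
    · exact ⟨l, 1, by simp, h, fun r hr h1 => absurd (Nat.dvd_one.1 h1) hr.one_lt.ne'⟩
    · obtain ⟨l', hl'⟩ := Nat.gcd_dvd_left l k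
      have hg : 0 < Nat.gcd l k := Nat.gcd_pos_of_pos_left _ hl
      have hpos : 0 < l' := Nat.pos_of_ne_zero (by rintro rfl; omega)
      have hlt : l' < l := by
        conv_rhs => rw [hl']
        exact (Nat.lt_mul_iff_one_lt_left hpos).2 (by rw [Nat.Coprime] at h; omega)
      obtain ⟨l₁, l₂, h1, h2, h3⟩ := ih l' hlt hpos
      refine ⟨l₁, Nat.gcd l k * l₂, ?_, h2, fun r hr hd => ?_⟩
      · conv_lhs => rw [hl', h1]
        ring
      · rcases hr.dvd_mul.1 hd with h4 | h4
        · exact h4.trans (Nat.gcd_dvd_right _ _)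
        · exact h3 r hr h4

/-- Two subsequences in the kernel that agree modulo `q`, along which `D x + s` is divisible by
large powers of `l₂`. -/
theorem exists_modEq_of_isRegular {D s l₁ l₂ q T : ℕ} {W : ℕ → ℕ} (hl₁ : 0 < l₁) (hl₂ : 0 < l₂)
    (hq : 0 < q) (hD : 0 < D) (hcop : Nat.Coprime D l₂)
    (hreg : IsRegular (l₁ * l₂) fun i => (W (i + 1) : ℤ)) :
    ∃ n n' R x x', n < n' ∧ 0 < R ∧ D * x + s = l₂ ^ (T * n) * R ∧
      D * x' + s = l₂ ^ (T * n') * R ∧ ∀ i, W ((l₁ * l₂) ^ (T * n) * i + x) ≡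
        W ((l₁ * l₂) ^ (T * n') * i + x') [MOD q] := by
  have : NeZero q := ⟨hq.ne'⟩
  have hj : ∀ n, ∃ j R, j < l₂ ^ (T * n) ∧ D * (j + 1) + s = l₂ ^ (T * n) * R := by
    intro n
    have hpos : 0 < l₂ ^ (T * n) := by positivity
    obtain ⟨i, -, hi⟩ := exists_large_modEq hpos (hcop.pow_right (T * n))
      ((D + s) * (l₂ ^ (T * n) - 1)) 0
    have h1 : l₂ ^ (T * n) ∣ D * (i % l₂ ^ (T * n) + 1) + s := by
      rw [← Nat.modEq_zero_iff_dvd]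
      have h2 : D * (i % l₂ ^ (T * n)) ≡ (D + s) * (l₂ ^ (T * n) - 1) [MOD l₂ ^ (T * n)] :=
        ((Nat.mod_modEq _ _).mul_left D).trans hi
      have h3 := h2.add_right (D + s)
      rw [show (D + s) * (l₂ ^ (T * n) - 1) + (D + s) = l₂ ^ (T * n) * (D + s) by
        obtain ⟨c, hc⟩ : ∃ c, l₂ ^ (T * n) = c + 1 := ⟨l₂ ^ (T * n) - 1, by omega⟩
        rw [hc, Nat.add_sub_cancel]; ring] at h3
      rw [mul_add, mul_one, add_assoc]
      exact h3.trans (Nat.modEq_zero_iff_dvd.2 (Dvd.intro _ rfl))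
    obtain ⟨R, hR⟩ := h1
    exact ⟨_, R, Nat.mod_lt _ hpos, hR⟩
  choose j R hj hR using hj
  have hRpos : ∀ n, 0 < R n := fun n => Nat.pos_of_ne_zero fun h => by
    have h1 := hR n
    have : 0 < D * (j n + 1) := by positivity
    rw [h] at h1; omega
  -- The cofactor `R` is bounded because `j n < l₂ ^ (T * n)`. So the pigeonhole principle applies
  -- to `R` together with the kernel sequence modulo `q`.
  have hRle : ∀ n, R n < D + s + 1 := by
    intro n
    have h1 : l₂ ^ (T * n) * R n ≤ l₂ ^ (T * n) * (D + s) := by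
      have h2 : D * (j n + 1) ≤ D * l₂ ^ (T * n) := Nat.mul_le_mul_left D (hj n)
      have h3 : s ≤ l₂ ^ (T * n) * s := Nat.le_mul_of_pos_left _ (by positivity)
      rw [← hR n, mul_add _ D s, mul_comm _ D]
      exact Nat.add_le_add h2 h3
    have := Nat.le_of_mul_le_mul_left h1 (by positivity)
    omega
  have hfin := (hreg.finite_mod q).to_subtype
  let g : ℕ → Fin (D + s + 1) × {t : ℕ → ZMod q | ∃ e j : ℕ, j < (l₁ * l₂) ^ e ∧
      t = fun i => (((W ((l₁ * l₂) ^ e * i + j + 1) : ℕ) : ℤ) : ZMod q)} := fun n =>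
    (⟨R n, hRle n⟩, ⟨_, T * n, j n, (hj n).trans_le (Nat.pow_le_pow_left
      (Nat.le_mul_of_pos_left _ hl₁) _), rfl⟩)
  obtain ⟨n, n', hne, hg⟩ := Finite.exists_ne_map_eq_of_infinite g
  wlog hlt : n < n' generalizing n n'
  · exact this n' n hne.symm hg.symm (by omega)
  have hg1 : R n = R n' := congrArg (fun x => x.1.1) hg
  have hg2 := congrArg (fun x => x.2.1) hg
  refine ⟨n, n', R n, j n + 1, j n' + 1, hlt, hRpos n, hR n, hg1 ▸ hR n', fun i => ?_⟩
  have h1 := congrFun hg2 i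
  simp only [g, Int.cast_natCast] at h1
  exact (ZMod.natCast_eq_natCast_iff _ _ _).1 h1

theorem exists_eq_pow_mul {k n : ℕ} (hk : 2 ≤ k) (hn : 0 < n) :
    ∃ v y, n = k ^ v * y ∧ ¬ k ∣ y := by
  obtain ⟨v, y, h1, h2⟩ := Nat.exists_eq_pow_mul_and_not_dvd hn.ne' k (by omega)
  exact ⟨v, y, h2, h1⟩

/-- A fixed word is not `l₁ l₂`-regular if `l₁ > 1` is coprime to `D + 1`. -/
theorem IsShiftFixed.eq_one_of_isRegular {D s l₁ l₂ : ℕ} {W : ℕ → ℕ} (hW : IsShiftFixed D s W)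
    (hD : 0 < D) (hl₁ : 0 < l₁) (hl₂ : 0 < l₂) (hcop₁ : Nat.Coprime l₁ (D + 1))
    (hcop : Nat.Coprime D l₂) (hreg : IsRegular (l₁ * l₂) fun i => (W (i + 1) : ℤ)) :
    l₁ = 1 := by
  by_contra hne
  obtain ⟨n, n', R, x, x', hlt, hR, hx, hx', hmod⟩ :=
    exists_modEq_of_isRegular (q := 3) (T := 1) hl₁ hl₂ (by norm_num) hD hcop hreg
  simp only [one_mul] at hx hx' hmod
  set k := D + 1 with hk
  obtain ⟨d, rfl⟩ : ∃ d, n' = n + d := ⟨n' - n, by omega⟩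
  have hl1d : 1 < l₁ ^ d := Nat.one_lt_pow (by omega) (by omega)
  obtain ⟨c, hc⟩ : ∃ c, l₁ ^ d = c + 1 := ⟨l₁ ^ d - 1, by omega⟩
  have hcpos : 0 < c := by omega
  obtain ⟨u, z, hz, hkz⟩ := exists_eq_pow_mul (k := k) (by omega) (show 0 < l₂ ^ n by positivity)
  obtain ⟨u', z', hz', hkz'⟩ := exists_eq_pow_mul (k := k) (by omega)
    (show 0 < l₂ ^ (n + d) * (R * c) by positivity)
  have hkD : Nat.Coprime (D * l₁ ^ n) k :=
    Nat.Coprime.mul_left (by simp [hk]) (hcop₁.pow_left n)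
  -- Choose `i` with `D l₁^n i + R ≡ k^r` modulo `k^(r+1)`. Along `n` the exponent of `k` is then `u
  -- + r`. Along `n + d` the number is a multiple of `k^(u'+1)` minus `l₂^(n+d) R (l₁^d - 1)`, so
  -- its exponent stays `u'`. Passing from `r = u' + 1` to `u' + 2` changes one letter by `2` and
  -- the other by `0`, which differ modulo `3`.
  have key : ∀ r, u' < r → ∃ i, (∃ y, D * ((l₁ * l₂) ^ n * i + x) + s = k ^ (u + r) * y ∧
      D * s + s < y ∧ y ≡ z [MOD k]) ∧
      ∃ y', D * ((l₁ * l₂) ^ (n + d) * i + x') + s = k ^ u' * y' ∧ D * s + s < y' ∧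
        y' + z' ≡ 0 [MOD k] := by
    intro r hr
    have hkr : 0 < k ^ r := by positivity
    obtain ⟨i, hi, hir⟩ := exists_large_modEq (n := k ^ (r + 1)) (by positivity)
      (hkD.pow_right (r + 1)) (k ^ r + R * (k ^ (r + 1) - 1))
      (k ^ r * (D * s + s + z' + 2))
    have h1 : D * l₁ ^ n * i + R ≡ k ^ r [MOD k ^ (r + 1)] := by
      have h2 := hir.add_right R
      have h3 : k ^ r + R * (k ^ (r + 1) - 1) + R = k ^ r + k ^ (r + 1) * R := by
        obtain ⟨e, he⟩ : ∃ e, k ^ (r + 1) = e + 1 :=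
          ⟨k ^ (r + 1) - 1, by have : 0 < k ^ (r + 1) := by positivity
                               omega⟩
        rw [he, Nat.add_sub_cancel]; ring
      rw [h3] at h2
      exact h2.trans (by simp [Nat.ModEq])
    have hbig : k ^ r * (D * s + s + z' + 2) ≤ D * l₁ ^ n * i :=
      hi.trans (Nat.le_mul_of_pos_left _ (by positivity))
    have hge : k ^ r ≤ D * l₁ ^ n * i + R := by
      have : k ^ r * 1 ≤ k ^ r * (D * s + s + z' + 2) := Nat.mul_le_mul_left _ (by omega)
      omega
    obtain ⟨t, ht⟩ := (Nat.modEq_iff_dvd' hge).1 h1.symm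
    have hX : D * l₁ ^ n * i + R = k ^ r * (1 + k * t) := by
      rw [mul_add, mul_one, ← mul_assoc, ← pow_succ]; omega
    have hY : D * s + s + z' + 2 ≤ 1 + k * t := by
      apply Nat.le_of_mul_le_mul_left _ hkr
      rw [← hX]; omega
    have hzpos : 0 < z := Nat.pos_of_ne_zero (by rintro rfl; simp at hkz)
    refine ⟨i, ⟨z * (1 + k * t), ?_, ?_, ?_⟩, ?_⟩
    · rw [mul_add, add_assoc, hx, mul_pow]
      calc D * (l₁ ^ n * l₂ ^ n * i) + l₂ ^ n * R = l₂ ^ n * (D * l₁ ^ n * i + R) := by ring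
        _ = k ^ (u + r) * (z * (1 + k * t)) := by rw [hX, hz, pow_add]; ring
    · have : 1 + k * t ≤ z * (1 + k * t) := Nat.le_mul_of_pos_left _ hzpos
      omega
    · simp [Nat.ModEq, mul_add, mul_left_comm z k t]
    · obtain ⟨e, rfl⟩ : ∃ e, r = u' + e + 1 := ⟨r - u' - 1, by omega⟩
      set N' := D * ((l₁ * l₂) ^ (n + d) * i + x') + s with hN'
      have h4 : N' + k ^ u' * z' = k ^ u' * (k * (k ^ e * (1 + k * t) * l₂ ^ (n + d) * l₁ ^ d)) := by
        rw [← hz', hN', mul_add, add_assoc _ _ s, hx']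
        calc D * ((l₁ * l₂) ^ (n + d) * i) + l₂ ^ (n + d) * R + l₂ ^ (n + d) * (R * c)
            = l₂ ^ (n + d) * (l₁ ^ d * (D * l₁ ^ n * i)) + l₂ ^ (n + d) * (R * (c + 1)) := by
              rw [mul_pow, pow_add l₁]; ring
          _ = l₂ ^ (n + d) * l₁ ^ d * (D * l₁ ^ n * i + R) := by rw [← hc]; ring
          _ = _ := by rw [hX]; ring
      have h5 : k ^ u' ∣ N' := (Nat.dvd_add_left (Dvd.intro _ rfl)).1 (h4 ▸ Dvd.intro _ rfl)
      obtain ⟨y', hy'⟩ := h5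
      have h6 : y' + z' = k * (k ^ e * (1 + k * t) * l₂ ^ (n + d) * l₁ ^ d) := by
        apply Nat.eq_of_mul_eq_mul_left (show 0 < k ^ u' by positivity)
        rw [← h4, hy', mul_add]
      refine ⟨y', hy', ?_, h6 ▸ by simp [Nat.ModEq]⟩
      have h7 : 1 + k * t ≤ k * (k ^ e * (1 + k * t) * l₂ ^ (n + d) * l₁ ^ d) := by
        calc 1 + k * t = 1 * (1 * (1 + k * t) * 1 * 1) := by ring
          _ ≤ k * (k ^ e * (1 + k * t) * l₂ ^ (n + d) * l₁ ^ d) := by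
            gcongr <;> first | omega | exact Nat.one_le_pow _ _ (by omega)
      omega
  obtain ⟨i, ⟨y, h1, h2, h3⟩, y', h4, h5, h6⟩ := key (u' + 1) (by omega)
  obtain ⟨j, ⟨w, g1, g2, g3⟩, w', g4, g5, g6⟩ := key (u' + 2) (by omega)
  have hdvd : ¬ k ∣ y := fun h => hkz ((h3.dvd_iff dvd_rfl).1 h)
  have hdvd' : ¬ k ∣ y' := fun h => hkz' ((Nat.dvd_add_right h).1 (Nat.modEq_zero_iff_dvd.1 h6))
  have e1 := hW.add_eq_add h1 g1 h2 g2 (h3.trans g3.symm) hdvd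
  have e2 := hW.add_eq_add h4 g4 h5 g5 (Nat.ModEq.add_right_cancel' z' (h6.trans g6.symm)) hdvd'
  have e3 := hmod i
  have e4 := hmod j
  simp only [Nat.ModEq] at e3 e4
  omega

/-- If `D + 1 = K₁ K₂ k₀` and a power of `l` has the form `K₁ ^ a₁ * K₂ ^ a₂ * c`, then `a₁ ≤ a₂`
provided that the fixed word is `l`-regular. -/
theorem IsShiftFixed.le_of_isRegular {D s l K₁ K₂ k₀ c a₁ a₂ E : ℕ} {W : ℕ → ℕ}
    (hW : IsShiftFixed D s W) (hD : 0 < D) (hl : 0 < l) (hcop : Nat.Coprime D l)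
    (hk : D + 1 = K₁ * K₂ * k₀) (hK₁ : 1 < K₁) (hK₂ : 1 < K₂) (h12 : Nat.Coprime K₁ K₂)
    (h10 : Nat.Coprime K₁ k₀) (h20 : Nat.Coprime K₂ k₀) (hc₁ : Nat.Coprime K₁ c)
    (hc₂ : Nat.Coprime K₂ c) (hL : l ^ E = K₁ ^ a₁ * K₂ ^ a₂ * c)
    (hreg : IsRegular l fun i => (W (i + 1) : ℤ)) : a₁ ≤ a₂ := by
  by_contra hlt
  obtain ⟨δ, hδ, rfl⟩ : ∃ δ, 1 ≤ δ ∧ a₁ = a₂ + δ := ⟨a₁ - a₂, by omega, by omega⟩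
  have hk₀ : 0 < k₀ := Nat.pos_of_ne_zero (by rintro rfl; simp at hk)
  have hcpos : 0 < c := Nat.pos_of_ne_zero (by rintro rfl; simp at hc₁; omega)
  have hDK₂ : Nat.Coprime K₂ D :=
    Nat.Coprime.coprime_dvd_left ⟨K₁ * k₀, by rw [hk]; ring⟩ (by simp : Nat.Coprime (D + 1) D)
  have hDk₀ : Nat.Coprime k₀ D :=
    Nat.Coprime.coprime_dvd_left ⟨K₁ * K₂, by rw [hk]; ring⟩ (by simp : Nat.Coprime (D + 1) D)
  -- Multiplication by `K₂ ^ π` is to be invisible modulo `K₁ k₀` and modulo `D`; the last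
  -- congruence does the same for `(K₁ k₀) ^ π` modulo `K₂`.
  obtain ⟨π, hπ, hπ1, hπ2, hπ3⟩ : ∃ π, 0 < π ∧ K₂ ^ π ≡ 1 [MOD K₁ * k₀] ∧ K₂ ^ π ≡ 1 [MOD D] ∧
      (K₁ * k₀) ^ π ≡ 1 [MOD K₂] := by
    have hpow : ∀ {g n : ℕ} (t : ℕ), Nat.Coprime g n → g ^ (n.totient * t) ≡ 1 [MOD n] := by
      intro g n t hg
      rw [pow_mul]
      simpa using (Nat.ModEq.pow_totient hg).pow t
    refine ⟨(K₁ * k₀).totient * D.totient * K₂.totient, ?_, ?_, ?_, ?_⟩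
    · have := Nat.totient_pos.2 (show 0 < K₁ * k₀ by positivity)
      have := Nat.totient_pos.2 hD
      have := Nat.totient_pos.2 (show 0 < K₂ by omega)
      positivity
    · rw [mul_assoc]
      exact hpow _ (h12.symm.mul_right h20)
    · rw [mul_comm (K₁ * k₀).totient, mul_assoc]
      exact hpow _ hDK₂
    · rw [mul_comm _ K₂.totient]
      exact hpow _ (h12.mul_left h20.symm)
  -- The final contradiction is a change by `2 π`, nonzero modulo `2 π + 1`. The factor `π + 2` in
  -- `T` separates `e` and `e'` enough for the surplus power of `K₁` below.
  obtain ⟨n, n', R, x, x', hnn, hR, hx, hx', hmod⟩ :=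
    exists_modEq_of_isRegular (l₁ := 1) (l₂ := l) (q := 2 * π + 1) (T := E * (π + 2)) (s := s)
      (W := W) one_pos hl (by omega) hD hcop (by rwa [one_mul])
  obtain ⟨d, rfl⟩ : ∃ d, n' = n + d + 1 := ⟨n' - n - 1, by omega⟩
  simp only [one_mul, mul_assoc E, pow_mul l E, hL] at hx hx' hmod
  set e := (π + 2) * n with he
  set e' := (π + 2) * (n + d + 1) with he'
  obtain ⟨ε, hε⟩ : ∃ ε, δ * e' = δ * e + 1 + (π + 1 + ε) := by
    have h1 : e' = e + (π + 2) + (π + 2) * d := by rw [he, he']; ring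
    refine ⟨δ * e' - (δ * e + 1 + (π + 1)), ?_⟩
    have h2 : 1 * (π + 2) ≤ δ * (π + 2) := Nat.mul_le_mul_right _ hδ
    have h3 : δ * e' = δ * e + δ * (π + 2) + δ * ((π + 2) * d) := by rw [h1]; ring
    omega
  set v := (a₂ + δ) * e with hv
  set v' := a₂ * e' + δ * e + 1 with hv'
  set k := D + 1 with hkdef
  -- With this power of `K₂`, the exponent of `k` is limited by `K₁` along `e` (`v` against `v + 1`)
  -- and by `K₂` along `e'` (`v' + π + 1 + ε` against `v'`); `k₀` never limits it. An extra factor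
  -- `K₂ ^ π` thus changes nothing along `e` but adds `π` along `e'`.
  set G := K₂ ^ (δ * e + 1) * k₀ ^ (v + v' + π + 1) with hG
  have hGpos : 0 < G := by positivity
  have hGD : Nat.Coprime G D := (hDK₂.pow_left _).mul_left (hDk₀.pow_left _)
  obtain ⟨z, hz, hzD⟩ := exists_large_modEq hD
    (hGD.mul_left (by simp [hkdef] : Nat.Coprime k D)) (R + G * (D - 1)) (D * s + s + R)
  set u := 1 + k * z with hu
  have hularge : D * s + s + R < u := by
    have : z ≤ k * z := Nat.le_mul_of_pos_left _ (by omega)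
    omega
  have huR : G * u ≡ R [MOD D] := by
    have h1 := hzD.add_right G
    rw [show R + G * (D - 1) + G = R + D * G by
      obtain ⟨D', rfl⟩ : ∃ D', D = D' + 1 := ⟨D - 1, by omega⟩
      rw [Nat.add_sub_cancel]; ring, show G * k * z + G = G * u by rw [hu]; ring] at h1
    exact h1.trans (by simp [Nat.ModEq])
  have hku : Nat.Coprime k u := by simp [hu]
  have hK₁u : Nat.Coprime K₁ u :=
    Nat.Coprime.coprime_dvd_left ⟨K₂ * k₀, by rw [hk]; ring⟩ hku
  have hK₂u : Nat.Coprime K₂ u :=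
    Nat.Coprime.coprime_dvd_left ⟨K₁ * k₀, by rw [hk]; ring⟩ hku
  have hGu : R ≤ G * u := by
    have : u ≤ G * u := Nat.le_mul_of_pos_left _ hGpos
    omega
  obtain ⟨i, hi⟩ : ∃ i, D * i + R = G * u := by
    obtain ⟨i, hi⟩ := (Nat.modEq_iff_dvd' hGu).1 huR.symm
    exact ⟨i, by omega⟩
  obtain ⟨j, hj⟩ : ∃ j, D * j + R = G * u * K₂ ^ π := by
    have h1 : R ≤ G * u * K₂ ^ π := hGu.trans (Nat.le_mul_of_pos_right _ (by positivity))
    obtain ⟨j, hj⟩ := (Nat.modEq_iff_dvd' h1).1 (by simpa using (huR.mul hπ2).symm)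
    exact ⟨j, by omega⟩
  have hval : ∀ {m f g i N : ℕ}, D * f + s = m * R → D * i + R = g → m * g = N →
      D * (m * i + f) + s = N := by
    intro m f g i N h1 h2 h3
    rw [← h3, ← h2, mul_add, mul_add, add_assoc, h1]; ring
  set y := K₂ * k₀ ^ (v' + π + 1) * c ^ e * u with hy
  set y' := K₁ ^ (π + 1 + ε) * k₀ ^ (v + π + 1) * c ^ e' * u with hy'
  set y'' := K₁ ^ (1 + ε) * k₀ ^ (v + 1) * c ^ e' * u with hy''
  have hN : (K₁ ^ (a₂ + δ) * K₂ ^ a₂ * c) ^ e * (G * u) = k ^ v * y := by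
    rw [hk, hG, hy, hv, mul_pow, mul_pow, ← pow_mul, ← pow_mul]
    ring
  have hN' : (K₁ ^ (a₂ + δ) * K₂ ^ a₂ * c) ^ e' * (G * u) = k ^ v' * y' := by
    have h1 : (a₂ + δ) * e' = v' + (π + 1 + ε) := by rw [add_mul, hε, hv']; ring
    rw [hk, hG, hy', mul_pow, mul_pow, ← pow_mul, ← pow_mul, h1,
      show v + v' + π + 1 = v' + (v + π + 1) by ring, pow_add K₁ v', pow_add k₀ v',
      show a₂ * e' = v' - (δ * e + 1) by omega]
    have h2 : K₂ ^ (v' - (δ * e + 1)) * K₂ ^ (δ * e + 1) = K₂ ^ v' := by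
      rw [← pow_add]; congr 1; omega
    rw [mul_pow, mul_pow, ← h2]
    ring
  have hyy : y' * K₂ ^ π = k ^ π * y'' := by
    rw [hk, hy', hy'']; ring
  have hupos : 0 < u := by omega
  have hlt1 : ∀ t, 0 < t → D * s + s < t * u := fun t ht => by
    have : u ≤ t * u := Nat.le_mul_of_pos_left _ ht
    omega
  have b1 : D * s + s < y := hlt1 _ (by positivity)
  have b2 : D * s + s < y' := hlt1 _ (by positivity)
  have b3 : D * s + s < y'' := hlt1 _ (by positivity)
  have b4 : D * s + s < y * K₂ ^ π := b1.trans_le (Nat.le_mul_of_pos_right _ (by positivity))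
  have m1 : y ≡ y * K₂ ^ π [MOD k] := by
    have h1 := ((hπ1.mul_left' K₂).mul_right (k₀ ^ (v' + π + 1) * c ^ e * u)).symm
    rw [show K₂ * (K₁ * k₀) = k by rw [hk]; ring, mul_one] at h1
    convert h1 using 1 <;> rw [hy] <;> ring
  have m2 : y' ≡ y'' [MOD k] := by
    have h1 := (hπ3.mul_left' (K₁ * k₀)).mul_right (K₁ ^ ε * k₀ ^ v * c ^ e' * u)
    rw [show K₁ * k₀ * K₂ = k by rw [hk]; ring, mul_one] at h1
    convert h1 using 1
    · rw [hy']; ring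
    · rw [hy'']; ring
  have d1 : ¬ k ∣ y := by
    intro h
    have h1 : K₁ ∣ y := Dvd.dvd.trans ⟨K₂ * k₀, by rw [hk]; ring⟩ h
    have h2 : Nat.Coprime K₁ y :=
      ((h12.mul_right (h10.pow_right _)).mul_right (hc₁.pow_right _)).mul_right hK₁u
    have := Nat.Coprime.eq_one_of_dvd h2 h1
    omega
  have d2 : ¬ k ∣ y' := by
    intro h
    have h1 : K₂ ∣ y' := Dvd.dvd.trans ⟨K₁ * k₀, by rw [hk]; ring⟩ h
    have h2 : Nat.Coprime K₂ y' :=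
      (((h12.symm.pow_right _).mul_right (h20.pow_right _)).mul_right
        (hc₂.pow_right _)).mul_right hK₂u
    have := Nat.Coprime.eq_one_of_dvd h2 h1
    omega
  have w1 := hW.add_eq_add (hval hx hi hN)
    (hval hx hj (show _ = k ^ v * (y * K₂ ^ π) by rw [← mul_assoc, hN, mul_assoc])) b1 b4 m1 d1
  have w2 := hW.add_eq_add (hval hx' hi hN')
    (hval hx' hj (show _ = k ^ (v' + π) * y'' by
      rw [← mul_assoc, hN', mul_assoc, hyy, pow_add k v' π, mul_assoc])) b2 b3 m2 d2
  have w3 := hmod i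
  have w4 := hmod j
  rw [show W ((K₁ ^ (a₂ + δ) * K₂ ^ a₂ * c) ^ e * i + x) =
    W ((K₁ ^ (a₂ + δ) * K₂ ^ a₂ * c) ^ e * j + x) by omega] at w3
  have w5 := w3.symm.trans w4
  rw [show W ((K₁ ^ (a₂ + δ) * K₂ ^ a₂ * c) ^ e' * j + x') =
    W ((K₁ ^ (a₂ + δ) * K₂ ^ a₂ * c) ^ e' * i + x') + 2 * π by omega] at w5
  have w6 := (Nat.modEq_iff_dvd' (Nat.le_add_right _ _)).1 w5
  rw [Nat.add_sub_cancel_left] at w6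
  have := Nat.le_of_dvd (by omega) w6
  omega

theorem exists_eq_pow_mul_pow_mul {n r₁ r₂ : ℕ} (hn : n ≠ 0) (h1 : r₁.Prime) (h2 : r₂.Prime)
    (h12 : r₁ ≠ r₂) : ∃ m, n = r₁ ^ n.factorization r₁ * r₂ ^ n.factorization r₂ * m ∧
      Nat.Coprime r₁ m ∧ Nat.Coprime r₂ m := by
  have hm : ordCompl[r₁] n ≠ 0 := (Nat.ordCompl_pos r₁ hn).ne'
  have h3 : (ordCompl[r₁] n).factorization r₂ = n.factorization r₂ := by
    rw [Nat.factorization_ordCompl, Finsupp.erase_ne h12.symm]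
  refine ⟨ordCompl[r₂] (ordCompl[r₁] n), ?_, ?_, Nat.coprime_ordCompl h2 hm⟩
  · conv_lhs => rw [← Nat.ordProj_mul_ordCompl_eq_self n r₁,
      ← Nat.ordProj_mul_ordCompl_eq_self (ordCompl[r₁] n) r₂]
    rw [h3, mul_assoc]
  · exact (Nat.coprime_ordCompl h1 hn).coprime_dvd_right (Nat.ordCompl_dvd _ _)

/-- A fixed word is regular only for the integers that are multiplicatively dependent on
`D + 1`. -/
theorem IsShiftFixed.multDependent_of_isRegular {D s l : ℕ} {W : ℕ → ℕ}
    (hW : IsShiftFixed D s W) (hD : 0 < D) (hl : 2 ≤ l)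
    (hreg : IsRegular l fun i => (W (i + 1) : ℤ)) : MultDependent l (D + 1) := by
  obtain ⟨l₁, l₂, rfl, h1, h2⟩ := exists_mul_coprime (D + 1) (show 0 < l by omega)
  have hl₁ : 0 < l₁ := Nat.pos_of_ne_zero (by rintro rfl; omega)
  have hl₂ : 0 < l₂ := Nat.pos_of_ne_zero (by rintro rfl; omega)
  have hcop : Nat.Coprime D l₂ := by
    refine Nat.Coprime.symm (Nat.coprime_of_dvd fun r hr h3 h4 => hr.one_lt.ne' ?_)
    exact Nat.dvd_one.1 ((Nat.dvd_add_right h4).1 (h2 r hr h3))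
  obtain rfl := hW.eq_one_of_isRegular hD hl₁ hl₂ h1 hcop hreg
  rw [one_mul] at hl hreg ⊢
  -- By symmetry in `r₁` and `r₂` this makes the prime exponents of `l₂` proportional to those of `D
  -- + 1`.
  have key : ∀ r₁ r₂ : ℕ, r₁.Prime → r₂.Prime → r₁ ∣ D + 1 → r₂ ∣ D + 1 →
      l₂.factorization r₁ * (D + 1).factorization r₂ ≤
        l₂.factorization r₂ * (D + 1).factorization r₁ := by
    intro r₁ r₂ p1 p2 hr1 hr2
    by_cases h12 : r₁ = r₂
    · rw [h12]
    obtain ⟨m, hm, hm1, hm2⟩ := exists_eq_pow_mul_pow_mul (Nat.succ_ne_zero D) p1 p2 h12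
    obtain ⟨c, hc, hc1, hc2⟩ := exists_eq_pow_mul_pow_mul hl₂.ne' p1 p2 h12
    have f1 := p1.factorization_pos_of_dvd (Nat.succ_ne_zero D) hr1
    have f2 := p2.factorization_pos_of_dvd (Nat.succ_ne_zero D) hr2
    rw [Nat.succ_eq_add_one] at hm f1 f2
    have hrr : Nat.Coprime r₁ r₂ := (Nat.coprime_primes p1 p2).2 h12
    refine hW.le_of_isRegular (K₁ := r₁ ^ (D + 1).factorization r₁)
      (K₂ := r₂ ^ (D + 1).factorization r₂) (k₀ := m)
      (c := c ^ ((D + 1).factorization r₁ * (D + 1).factorization r₂))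
      (E := (D + 1).factorization r₁ * (D + 1).factorization r₂) hD hl₂ hcop hm
      (Nat.one_lt_pow f1.ne' p1.one_lt) (Nat.one_lt_pow f2.ne' p2.one_lt)
      (hrr.pow _ _) (hm1.pow_left _) (hm2.pow_left _) (hc1.pow _ _) (hc2.pow _ _) ?_ hreg
    conv_lhs => rw [hc]
    rw [mul_pow, mul_pow, ← pow_mul, ← pow_mul, ← pow_mul, ← pow_mul]
    congr 3 <;> ring
  obtain ⟨r, hr, hrl⟩ := Nat.exists_prime_and_dvd (show l₂ ≠ 1 by omega)
  have hrk := h2 r hr hrl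
  refine ⟨(D + 1).factorization r, l₂.factorization r,
    hr.factorization_pos_of_dvd (Nat.succ_ne_zero D) hrk,
    hr.factorization_pos_of_dvd hl₂.ne' hrl, ?_⟩
  apply Nat.eq_of_factorization_eq (by positivity) (by positivity)
  intro t
  rw [Nat.factorization_pow, Nat.factorization_pow, Finsupp.smul_apply, Finsupp.smul_apply,
    smul_eq_mul, smul_eq_mul]
  by_cases ht : t.Prime ∧ t ∣ D + 1
  · have k1 := key r t hr ht.1 hrk ht.2
    have k2 := key t r ht.1 hr ht.2 hrk
    rw [mul_comm]
    omega
  · have z1 : l₂.factorization t = 0 := by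
      rw [Nat.factorization_eq_zero_iff]
      by_contra h
      push Not at h
      exact ht ⟨h.1, h2 t h.1 h.2.1⟩
    have z2 : (D + 1).factorization t = 0 := by
      rw [Nat.factorization_eq_zero_iff]
      by_contra h
      push Not at h
      exact ht ⟨h.1, h.2.1⟩
    rw [z1, z2, mul_zero, mul_zero]

/-! ### Regularity for the dependent integers -/

/-- The linear map that takes a sequence to its subsequence along `k i + j`. -/
def decimate (k j : ℕ) : (ℕ → ℤ) →ₗ[ℤ] (ℕ → ℤ) where
  toFun u i := u (k * i + j)
  map_add' _ _ := rfl
  map_smul' _ _ := rfl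

theorem isRegular_of_span_kernel_le {k : ℕ} {s : ℕ → ℤ} {M : Submodule ℤ (ℕ → ℤ)} (hM : M.FG)
    (h : kernel k s ⊆ M) : IsRegular k s :=
  isNoetherian_submodule.1 (isNoetherian_of_fg_of_noetherian M hM) _ (Submodule.span_le.2 h)

theorem isRegular_of_decimate_le {k : ℕ} {s : ℕ → ℤ} {M : Submodule ℤ (ℕ → ℤ)}
    (hM : M.FG) (hs : s ∈ M) (h : ∀ j < k, ∀ u ∈ M, decimate k j u ∈ M) : IsRegular k s := by
  refine isRegular_of_span_kernel_le hM ?_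
  have key : ∀ e, ∀ j < k ^ e, ∀ u ∈ M, decimate (k ^ e) j u ∈ M := by
    intro e
    induction e with
    | zero =>
      intro j hj u hu
      obtain rfl : j = 0 := by simpa using hj
      convert hu using 1
      ext i
      simp [decimate]
    | succ e ih =>
      intro j hj u hu
      have hk : 0 < k := Nat.pos_of_ne_zero (by rintro rfl; simp at hj)
      have h1 := ih (j / k) (Nat.div_lt_of_lt_mul (by rwa [← pow_succ'])) _
        (h (j % k) (Nat.mod_lt _ hk) u hu)
      convert h1 using 1
      ext i
      have h2 := Nat.div_add_mod j k
      simp only [decimate, LinearMap.coe_mk, AddHom.coe_mk]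
      congr 1
      conv_lhs => rw [← h2]
      ring
  rintro t ⟨e, j, hj, rfl⟩
  exact key e j hj s hs

theorem IsRegular.pow {k : ℕ} {s : ℕ → ℤ} (h : IsRegular k s) (t : ℕ) : IsRegular (k ^ t) s := by
  refine isRegular_of_span_kernel_le h ?_
  rintro _ ⟨e, j, hj, rfl⟩
  exact Submodule.subset_span ⟨t * e, j, by rwa [pow_mul], by rw [pow_mul]⟩

/-- Writing `e = t (e / t) + e % t` exhibits each kernel sequence for `l` as a further decimation,
by one of finitely many powers of `l`, of a kernel sequence for `l ^ t`. -/
theorem IsRegular.of_pow {l t : ℕ} {s : ℕ → ℤ} (hl : 0 < l) (ht : 0 < t)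
    (h : IsRegular (l ^ t) s) : IsRegular l s := by
  refine isRegular_of_span_kernel_le (M := ⨆ x : Fin t × Fin (l ^ t),
    (Submodule.span ℤ (kernel (l ^ t) s)).map (decimate (l ^ x.1.1) x.2.1))
    (Submodule.fg_iSup _ fun x => h.map _) ?_
  rintro _ ⟨e, j, hj, rfl⟩
  have h1 := Nat.div_add_mod e t
  have h2 := Nat.mod_lt e ht
  have hpos : 0 < (l ^ t) ^ (e / t) := by positivity
  have h3 : l ^ e = (l ^ t) ^ (e / t) * l ^ (e % t) := by rw [← pow_mul, ← pow_add, h1]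
  have h4 : j / (l ^ t) ^ (e / t) < l ^ (e % t) := Nat.div_lt_of_lt_mul (by rwa [← h3])
  have h5 : l ^ (e % t) ≤ l ^ t := Nat.pow_le_pow_right hl h2.le
  refine Submodule.mem_iSup_of_mem (⟨e % t, h2⟩, ⟨_, h4.trans_le h5⟩) ?_
  refine ⟨_, Submodule.subset_span ⟨e / t, j % (l ^ t) ^ (e / t), Nat.mod_lt _ hpos, rfl⟩, ?_⟩
  ext i
  simp only [decimate, LinearMap.coe_mk, AddHom.coe_mk]
  congr 1
  rw [h3]
  conv_rhs => rw [← Nat.div_add_mod j ((l ^ t) ^ (e / t))]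
  ring

/-- The span of `W (i + 1)`, `W i`, the constant `1` and the indicator of `0` is stable under
decimation: the residue `s` gives `W i + 2`, all others give constants, and the indicator corrects
the value at `i = 0`, where the transient interferes. -/
theorem IsShiftFixed.isRegular {D s : ℕ} {W : ℕ → ℕ} (hW : IsShiftFixed D s W) (hs : 0 < s)
    (hsD : s ≤ D) : IsRegular (D + 1) fun i => (W (i + 1) : ℤ) := by
  let g₁ : ℕ → ℤ := fun i => W (i + 1)
  let g₂ : ℕ → ℤ := fun i => W i
  let one : ℕ → ℤ := fun _ => 1
  let δ : ℕ → ℤ := fun i => if i = 0 then 1 else 0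
  let M : Submodule ℤ (ℕ → ℤ) := Submodule.span ℤ {g₁, g₂, one, δ}
  have m1 : g₁ ∈ M := Submodule.subset_span (by simp)
  have m2 : g₂ ∈ M := Submodule.subset_span (by simp)
  have m3 : one ∈ M := Submodule.subset_span (by simp)
  have m4 : δ ∈ M := Submodule.subset_span (by simp)
  have hdec : ∀ r ≤ D + 1, (fun i => (W ((D + 1) * i + r) : ℤ)) ∈ M := by
    intro r hr
    rcases lt_trichotomy r s with h | h | h
    · have e1 : (fun i => (W ((D + 1) * i + r) : ℤ)) = (W (D + 1 + r) : ℤ) • one +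
          ((W r : ℤ) - W (D + 1 + r)) • δ := by
        ext i
        obtain _ | i := i
        · simp [one, δ]
        · have := hW.periodic i 0 (D + 1 + r - s) (by omega) (by omega)
          rw [show s + (D + 1) * i + (D + 1 + r - s) = (D + 1) * (i + 1) + r by
            rw [mul_add]; omega, show s + (D + 1) * 0 + (D + 1 + r - s) = D + 1 + r by omega]
            at this
          simp [one, δ, this]
      rw [e1]
      exact M.add_mem (M.smul_mem _ m3) (M.smul_mem _ m4)
    · have e1 : (fun i => (W ((D + 1) * i + r) : ℤ)) = g₂ + (2 : ℤ) • one +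
          ((W s : ℤ) - W 0 - 2) • δ := by
        ext i
        obtain _ | i := i
        · simp [one, δ, g₂, h]
        · have := hW.last (i + 1) (by omega)
          rw [add_comm, ← h] at this
          simp [one, δ, g₂, this]
      rw [e1]
      exact M.add_mem (M.add_mem m2 (M.smul_mem _ m3)) (M.smul_mem _ m4)
    · have e1 : (fun i => (W ((D + 1) * i + r) : ℤ)) = (W r : ℤ) • one := by
        ext i
        have := hW.periodic i 0 (r - s) (by omega) (by omega)
        rw [show s + (D + 1) * i + (r - s) = (D + 1) * i + r by omega,
          show s + (D + 1) * 0 + (r - s) = r by omega] at this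
        simp [one, this]
      rw [e1]
      exact M.smul_mem _ m3
  refine isRegular_of_decimate_le (M := M) (Submodule.fg_span (Set.toFinite _)) m1
    fun j hj u hu => ?_
  have hle : M ≤ M.comap (decimate (D + 1) j) := by
    refine Submodule.span_le.2 ?_
    rintro _ (rfl | rfl | rfl | rfl)
    · exact hdec (j + 1) (by omega)
    · exact hdec j (by omega)
    · exact m3
    · change decimate (D + 1) j δ ∈ M
      rcases Nat.eq_zero_or_pos j with rfl | h
      · convert m4 using 1
        ext i
        simp [decimate, δ]
      · convert M.zero_mem using 1
        ext i
        simp [decimate, δ, h.ne']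
  exact hle hu

theorem IsSelfSimilar.isShiftFixed {p q : ℕ} {W : ℕ → ℕ} (hW : IsSelfSimilar p q W) {D : ℕ}
    (hD : D + 1 = 111 * p + 51 * q) : IsShiftFixed D (13 * p + 6 * q) W where
  periodic x y r h h' := by
    rw [hD] at h' ⊢
    exact hW.periodic x y r h h'
  last x hx := by
    rw [hD]
    exact hW.last x hx

theorem IsSelfSimilar.isRegular_iff {p q : ℕ} {W : ℕ → ℕ} (hW : IsSelfSimilar p q W)
    (hp : 0 < p) {l : ℕ} (hl : 2 ≤ l) :
    IsRegular l (fun i => (W (i + 1) : ℤ)) ↔ MultDependent l (111 * p + 51 * q) := by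
  obtain ⟨D, hD⟩ : ∃ D, D + 1 = 111 * p + 51 * q := ⟨111 * p + 51 * q - 1, by omega⟩
  have h := hW.isShiftFixed hD
  rw [← hD]
  constructor
  · exact h.multDependent_of_isRegular (by omega) hl
  · rintro ⟨m, n, hm, hn, hmn⟩
    refine IsRegular.of_pow (by omega) hm ?_
    rw [hmn]
    exact (h.isRegular (by omega) (by omega)).pow n

end LexLeast

/-! ### The main theorem -/

theorem theorem37 (a b : ℕ) (ha : 0 < a) (hb : 0 < b) (hab : Nat.Coprime a b)
    (h_lower : (9 / 7 : ℚ) < (a : ℚ) / (b : ℚ)) (h_upper : (a : ℚ) / (b : ℚ) < (4 / 3 : ℚ))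
    (hb24 : Nat.gcd b 24 = 1) :
    (∀ n : ℕ, ((LexLeast.phi a b (.num n)).length : ℤ) = 24 * (a : ℤ) - 15 * (b : ℤ)) ∧
    LexLeast.IsLexLeastPowerFree a b
      (fun i => LexLeast.tau (LexLeast.morphLimit (LexLeast.phi a b) .zeroPrime i)) ∧
    LexLeast.RhoEq a b (24 * a - 15 * b) := by
  have hb' : (0 : ℚ) < b := by exact_mod_cast hb
  have h1 : 9 * b < 7 * a := by
    rw [div_lt_div_iff₀ (by norm_num) hb'] at h_lower
    have : (9 : ℚ) * b < 7 * a := by linarith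
    exact_mod_cast this
  have h2 : 3 * a < 4 * b := by
    rw [div_lt_div_iff₀ hb' (by norm_num)] at h_upper
    have : (3 : ℚ) * a < 4 * b := by linarith
    exact_mod_cast this
  obtain ⟨p, q, hp, hq, rfl, rfl⟩ : ∃ p q, 0 < p ∧ 0 < q ∧ a = 9 * p + 4 * q ∧
      b = 7 * p + 3 * q :=
    ⟨4 * b - 3 * a, 7 * a - 9 * b, by omega, by omega, by omega, by omega⟩
  have hk : 24 * (9 * p + 4 * q) - 15 * (7 * p + 3 * q) = 111 * p + 51 * q := by omega
  -- If `p = q`, then `b = 10 p` is even.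
  have hpq : p ≠ q := by
    rintro rfl
    have : 2 ∣ Nat.gcd (7 * p + 3 * p) 24 := Nat.dvd_gcd ⟨5 * p, by ring⟩ (by norm_num)
    rw [hb24] at this
    omega
  -- The block length is `24 a - 15 b ≡ 24 a` modulo `b`, and both `24` and `a` are coprime to `b`.
  have hcop : Nat.Coprime (111 * p + 51 * q) (7 * p + 3 * q) := by
    have h3 : Nat.Coprime (24 * (9 * p + 4 * q)) (7 * p + 3 * q) :=
      (Nat.Coprime.symm hb24).mul_left hab
    rw [show 24 * (9 * p + 4 * q) = 111 * p + 51 * q + 15 * (7 * p + 3 * q) by ring] at h3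
    exact (Nat.coprime_add_mul_right_left _ _ _).1 h3
  have hleast := LexLeast.limitWord_isLexLeastPowerFree hp hq hpq rfl rfl hcop
  have hself := LexLeast.limitWord_isSelfSimilar (a := ((9 * p + 4 * q : ℕ) : ℤ))
    (b := ((7 * p + 3 * q : ℕ) : ℤ)) hp hq (by push_cast; ring) (by push_cast; ring)
  refine ⟨fun n => ?_, hleast, by omega, _, hleast, ?_⟩
  · rw [LexLeast.phi, List.length_map, LexLeast.length_phiNum hp hq (by push_cast; ring)
      (by push_cast; ring)]
    push_cast
    ring
  · ext l
    rw [hk]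
    exact and_congr_right fun hl => hself.isRegular_iff hp hl
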